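/- Let $A$ be one of the real $*$-algebras $\mathbb{C}$, $\mathbb{H}$, $\mathbb{O}$ (complex numbers, quaternions, octonions), with conjugation $x\mapsto x^c$ and Euclidean norm $|x|=\sqrt{xx^c}$. Put $\mathbb{S}=\{J\in A : J+J^c=0,\ JJ^c=1\}$, $\mathbb{C}_J=\mathbb{R}+\mathbb{R}J$ for $J\in\mathbb S$, $\mathrm{Re}(x)=\frac12(x+x^c)$ and $\mathrm{Im}(x)=\frac12(x-x^c)$. For $E\subseteq\mathbb{C}$ let $\Omega_E=\{\alpha+\beta J : J\in\mathbb{S},\ \alpha+i\beta\in E\}\subseteq A$; sets of this form are called circular. A *slice domain* is a set $\Omega_D$ with $D\subseteq\mathbb{C}$ open, connected, invariant under complex conjugation and meeting $\mathbb{R}$. A *product domain* is a set $\Omega_D$ with $D\subseteq\mathbb C$ open, disjoint from $\mathbb{R}$ and having exactly two connected components, which are switched by complex conjugation. *Slice functions.* Let $A\otimes\mathbb{C}=A+\iota A$ have the product $(a+\iota b)(c+\iota d)=ac-bd+\iota(ad+bc)$ and the involution $(a+\iota b)^c=a^c+\iota b^c$. A stem function on a conjugation-invariant set $D\subseteq\mathbb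 C$ is a map $F=F_1+\iota F_2:D\to A+\iota A$ with $F_1(\bar z)=F_1(z)$ and $F_2(\bar z)=-F_2(z)$; it induces the slice function $f:\Omega_D\to A$, $f(\alpha+\beta J)=F_1(\alpha+i\beta)+JF_2(\alpha+i\beta)$. If $F,G$ induce $f,g$, then $FG$ induces the slice product $f\cdot g$ and $F^c$ induces the slice conjugate $f^c$; $N(f)=f\cdot f^c$. On a circular open set $U$, $f$ is slice regular if it is induced by a holomorphic stem function ($\partial_\alpha F_1=\partial_\beta F_2$, $\partial_\beta F_1=-\partial_\alpha F_2$). *Singularities.* If $x,y$ lie in a common $\mathbb{C}_J$, put $\sigma(x,y)=\tau(x,y)=|x-y|$; otherwise put $$\sigma(x,y)=\sqrt{|\mathrm{Re}\,x-\mathrm{Re}\,y|^2+(|\mathrm{Im}\,x|+|\mathrm{Im}\,y|)^2},\qquad \tau(x,y)=\sqrt{|\mathrm{Re}\,x-\mathrm{Re}\,y|^2+(|\mathrm{Im}\,x|-|\mathrm{Im}\,y|)^2}.$$ Let $\Sigma(y,0,R)=\{x\in A:\tau(x,y)>0,\ \sigma(x,y)<R\}$. Let $f$ be slice regular on the circular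 open set $U$. A point $y\in A$ is a singularity of $f$ if $\Sigma(y,0,R)\subseteq U$ for some $R>0$. It is a *pole* if moreover, for such an $R$, $f(x)=\sum_{n\in\mathbb{Z}}(x-y)^{\bullet n}\cdot a_n$ on $\Sigma(y,0,R)$ with coefficients $a_n\in A$ and some $m\ge 0$ such that $a_n=0$ for all $n<-m$, where $(x-y)^{\bullet n}$ is the $n$-th power of the function $x\mapsto x-y$ with respect to the slice product. It is a *removable singularity* if it is a singularity and $f$ extends to a slice regular function on a circular open set containing $y$. *Semiregular functions.* Let $\Omega\subseteq A$ be a nonempty circular open set. A semiregular function on $\Omega$ is a slice regular function $f$ on a circular open subset $U\subseteq\Omega$ such that every point of $\Omega\setminus U$ is a pole or a removable singularity for $f$. Let $\mathcal{SEM}(\Omega)$ be the set of these functions, two of them being identified if they coincide on the intersection of their domains. **Theorem.** The sum, the slice product (both defined on the intersection of the domains), the real multiples and the slice conjugates of semiregular functions on $\Omega$ are semiregular on $\Omega$, and with the operations $+,\cdot,{}^c$ induced in this way $\mathcal{SEM}(\Omega)$ is an alternative real $*$-algebra: it is a real algebra, not necessarily associative, with unit the constant function $1$; the associator $(a,b,c)=(ab)c-a(bc)$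 vanishes whenever two of its arguments coincide; and ${}^c$ is a real-linear involution with $(ab)^c=b^ca^c$. 1. If $\Omega$ is a slice domain, then $\mathcal{SEM}(\Omega)$ is a division algebra: it is nonzero, every $a\neq0$ has a two-sided multiplicative inverse, and for all $a\ne0$ and $b$ each of the equations $ax=b$ and $xa=b$ has exactly one solution. 2. If $\Omega$ is a product domain, then $\mathcal{SEM}(\Omega)$ is singular, that is, it contains some $f\not\equiv0$ with $N(f)\equiv0$. However, every $f\in\mathcal{SEM}(\Omega)$ with $N(f)\not\equiv0$ has a two-sided multiplicative inverse in $\mathcal{SEM}(\Omega)$. -/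

import Mathlib

open scoped Quaternion Topology

/-! ### Normed rings without associativity, and the three algebras `ℂ`, `ℍ`, `𝕆` -/

/-- A unital ring, not assumed associative, with a submultiplicative norm: Mathlib's `NormedRing`
without associativity. -/
class NonAssocNormedRing (A : Type*) extends Norm A, NonAssocRing A, MetricSpace A where
  dist_eq : ∀ x y, dist x y = norm (-x + y)
  norm_mul_le : ∀ a b, norm (a * b) ≤ norm a * norm b

namespace NonAssocNormedRing

instance toNormedAddCommGroup' {A : Type*} [i : NonAssocNormedRing A] : NormedAddCommGroup A :=
  { i with }

instance (priority := 50) ofNormedRing {A : Type*} [i : NormedRing A] : NonAssocNormedRing A :=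
  { i with }

instance {A : Type*} [NonAssocNormedRing A] : ContinuousMul A where
  continuous_mul := by
    let B : A →+ A →+ A := AddMonoidHom.mul
    refine continuous_iff_continuousAt.2 fun p => ?_
    rw [ContinuousAt, tendsto_iff_norm_sub_tendsto_zero]
    have key : ∀ q : A × A, ‖q.1 * q.2 - p.1 * p.2‖ ≤
        ‖q.1‖ * ‖q.2 - p.2‖ + ‖q.1 - p.1‖ * ‖p.2‖ := by
      intro q
      have : q.1 * q.2 - p.1 * p.2 = q.1 * (q.2 - p.2) + (q.1 - p.1) * p.2 := by
        rw [mul_sub, sub_mul]; abel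
      rw [this]
      exact (norm_add_le _ _).trans (add_le_add (norm_mul_le _ _) (norm_mul_le _ _))
    refine squeeze_zero (fun _ => norm_nonneg _) key ?_
    have hc : Continuous fun q : A × A =>
        ‖q.1‖ * ‖q.2 - p.2‖ + ‖q.1 - p.1‖ * ‖p.2‖ := by fun_prop
    have := hc.tendsto p
    simpa using this

end NonAssocNormedRing

/-- The octonions, `𝕆 = ℍ + ℓℍ`; the pair `⟨α, β⟩` stands for `α + ℓβ`. -/
@[ext]
structure Octonion where
  fst : ℍ[ℝ]
  snd : ℍ[ℝ]

namespace Octonion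

noncomputable instance : Zero Octonion := ⟨⟨0, 0⟩⟩
noncomputable instance : One Octonion := ⟨⟨1, 0⟩⟩
noncomputable instance : Add Octonion := ⟨fun x y => ⟨x.fst + y.fst, x.snd + y.snd⟩⟩
noncomputable instance : Neg Octonion := ⟨fun x => ⟨-x.fst, -x.snd⟩⟩
noncomputable instance : Sub Octonion := ⟨fun x y => ⟨x.fst - y.fst, x.snd - y.snd⟩⟩
noncomputable instance : SMul ℕ Octonion := ⟨fun n x => ⟨n • x.fst, n • x.snd⟩⟩
noncomputable instance : SMul ℤ Octonion := ⟨fun n x => ⟨n • x.fst, n • x.snd⟩⟩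
noncomputable instance : SMul ℝ Octonion := ⟨fun r x => ⟨r • x.fst, r • x.snd⟩⟩

/-- `(α + ℓβ)(γ + ℓδ) = αγ - δβᶜ + ℓ(αᶜδ + γβ)`. -/
noncomputable instance : Mul Octonion :=
  ⟨fun x y => ⟨x.fst * y.fst - y.snd * star x.snd, star x.fst * y.snd + y.fst * x.snd⟩⟩

/-- `(α + ℓβ)ᶜ = αᶜ - ℓβ`. -/
noncomputable instance : Star Octonion := ⟨fun x => ⟨star x.fst, -x.snd⟩⟩

/-- The Euclidean norm. -/
noncomputable instance : Norm Octonion := ⟨fun x => √(‖x.fst‖ ^ 2 + ‖x.snd‖ ^ 2)⟩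

@[simp] theorem fst_zero : (0 : Octonion).fst = 0 := rfl
@[simp] theorem snd_zero : (0 : Octonion).snd = 0 := rfl
@[simp] theorem fst_one : (1 : Octonion).fst = 1 := rfl
@[simp] theorem snd_one : (1 : Octonion).snd = 0 := rfl
@[simp] theorem fst_add (x y : Octonion) : (x + y).fst = x.fst + y.fst := rfl
@[simp] theorem snd_add (x y : Octonion) : (x + y).snd = x.snd + y.snd := rfl
@[simp] theorem fst_neg (x : Octonion) : (-x).fst = -x.fst := rfl
@[simp] theorem snd_neg (x : Octonion) : (-x).snd = -x.snd := rfl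
@[simp] theorem fst_sub (x y : Octonion) : (x - y).fst = x.fst - y.fst := rfl
@[simp] theorem snd_sub (x y : Octonion) : (x - y).snd = x.snd - y.snd := rfl
@[simp] theorem fst_smul (r : ℝ) (x : Octonion) : (r • x).fst = r • x.fst := rfl
@[simp] theorem snd_smul (r : ℝ) (x : Octonion) : (r • x).snd = r • x.snd := rfl
@[simp] theorem fst_mul (x y : Octonion) :
    (x * y).fst = x.fst * y.fst - y.snd * star x.snd := rfl
@[simp] theorem snd_mul (x y : Octonion) :
    (x * y).snd = star x.fst * y.snd + y.fst * x.snd := rfl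
@[simp] theorem fst_star (x : Octonion) : (star x).fst = star x.fst := rfl
@[simp] theorem snd_star (x : Octonion) : (star x).snd = -x.snd := rfl

theorem norm_def (x : Octonion) : ‖x‖ = √(‖x.fst‖ ^ 2 + ‖x.snd‖ ^ 2) := rfl

theorem norm_sq (x : Octonion) : ‖x‖ ^ 2 = ‖x.fst‖ ^ 2 + ‖x.snd‖ ^ 2 :=
  Real.sq_sqrt (by positivity)

theorem norm_eq_toLp (x : Octonion) : ‖x‖ = ‖WithLp.toLp 2 (x.fst, x.snd)‖ := by
  rw [WithLp.prod_norm_eq_of_L2]; rfl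

/-- The pair of quaternionic coordinates. -/
def toProd (x : Octonion) : ℍ[ℝ] × ℍ[ℝ] := (x.fst, x.snd)

theorem toProd_injective : Function.Injective toProd := fun x y h => by
  simp only [toProd, Prod.mk.injEq] at h
  exact Octonion.ext h.1 h.2

noncomputable instance : AddCommGroup Octonion :=
  toProd_injective.addCommGroup toProd rfl (fun _ _ => rfl) (fun _ => rfl) (fun _ _ => rfl)
    (fun _ _ => rfl) (fun _ _ => rfl)

noncomputable instance : NonAssocRing Octonion :=
  { (inferInstance : AddCommGroup Octonion), (inferInstance : Mul Octonion),
    (inferInstance : One Octonion) with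
    left_distrib := fun x y z => by
      ext1 <;> simp only [fst_mul, snd_mul, fst_add, snd_add, mul_add, add_mul] <;> abel
    right_distrib := fun x y z => by
      ext1 <;> simp only [fst_mul, snd_mul, fst_add, snd_add, mul_add, add_mul, star_add] <;> abel
    zero_mul := fun x => by ext1 <;> simp
    mul_zero := fun x => by ext1 <;> simp
    one_mul := fun x => by ext1 <;> simp
    mul_one := fun x => by ext1 <;> simp }

noncomputable instance : StarRing Octonion where
  star_involutive x := by ext1 <;> simp
  star_mul x y := by ext1 <;> simp [add_comm]
  star_add x y := by ext1 <;> simp [add_comm]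

theorem norm_mul (x y : Octonion) : ‖x * y‖ = ‖x‖ * ‖y‖ := by
  have h0 : ∀ w : Octonion, 0 ≤ ‖w‖ := fun w => Real.sqrt_nonneg _
  refine (sq_eq_sq₀ (h0 _) (mul_nonneg (h0 _) (h0 _))).1 ?_
  rw [mul_pow, norm_sq, norm_sq, norm_sq]
  simp only [sq, ← Quaternion.normSq_eq_norm_mul_self, Quaternion.normSq_def', fst_mul, snd_mul]
  simp
  ring

noncomputable instance : NonAssocNormedRing Octonion :=
  { (AddGroupNorm.toNormedAddCommGroup
      { toFun := fun x : Octonion => ‖x‖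
        map_zero' := by simp [norm_def]
        add_le' := fun x y => by
          simp only [norm_eq_toLp]
          exact norm_add_le (WithLp.toLp 2 (x.fst, x.snd)) (WithLp.toLp 2 (y.fst, y.snd))
        neg' := fun x => by simp [norm_def]
        eq_zero_of_map_eq_zero' := fun x h => by
          rw [norm_eq_toLp, norm_eq_zero] at h
          have h' := congrArg WithLp.ofLp h
          simp only [WithLp.ofLp_zero, Prod.mk_eq_zero] at h'
          exact Octonion.ext h'.1 h'.2 } : NormedAddCommGroup Octonion),
    (inferInstance : NonAssocRing Octonion) with
    norm_mul_le := fun x y => (norm_mul x y).le }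

noncomputable instance : NormedSpace ℝ Octonion where
  one_smul x := by ext1 <;> simp
  mul_smul r s x := by ext1 <;> simp [mul_smul]
  smul_zero r := by ext1 <;> simp
  smul_add r x y := by ext1 <;> simp
  add_smul r s x := by ext1 <;> simp [add_smul]
  zero_smul x := by ext1 <;> simp
  norm_smul_le r x := by
    rw [norm_eq_toLp, norm_eq_toLp]
    exact norm_smul_le r (WithLp.toLp 2 (x.fst, x.snd))

end Octonion

/-- Labels for the three algebras `ℂ`, `ℍ`, `𝕆`. -/
inductive HypercomplexType
  | complex
  | quaternion
  | octonion

namespace HypercomplexType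

/-- The algebra `ℂ`, `ℍ` or `𝕆` with the given label. -/
def Carrier : HypercomplexType → Type
  | complex => ℂ
  | quaternion => ℍ[ℝ]
  | octonion => Octonion

noncomputable instance : (k : HypercomplexType) → NonAssocNormedRing k.Carrier
  | complex => inferInstanceAs (NonAssocNormedRing ℂ)
  | quaternion => inferInstanceAs (NonAssocNormedRing ℍ[ℝ])
  | octonion => inferInstanceAs (NonAssocNormedRing Octonion)

noncomputable instance : (k : HypercomplexType) → StarRing k.Carrier
  | complex => inferInstanceAs (StarRing ℂ)
  | quaternion => inferInstanceAs (StarRing ℍ[ℝ])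
  | octonion => inferInstanceAs (StarRing Octonion)

noncomputable instance : (k : HypercomplexType) → NormedSpace ℝ k.Carrier
  | complex => inferInstanceAs (NormedSpace ℝ ℂ)
  | quaternion => inferInstanceAs (NormedSpace ℝ ℍ[ℝ])
  | octonion => inferInstanceAs (NormedSpace ℝ Octonion)

end HypercomplexType

/-! ### The complexification `A ⊗ ℂ` of a `*`-algebra `A` -/

/-- The complexification `A + ιA`; the pair `⟨a, b⟩` stands for `a + ιb`. -/
@[ext]
structure Complexification (A : Type*) where
  re : A
  im : A

namespace Complexification

variable {A : Type*} [NonAssocNormedRing A] [StarRing A] [NormedSpace ℝ A]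

/-- `(a + ιb)(c + ιd) = ac - bd + ι(ad + bc)`. -/
instance : Mul (Complexification A) :=
  ⟨fun v w => ⟨v.re * w.re - v.im * w.im, v.re * w.im + v.im * w.re⟩⟩

/-- The element `a + ι0`. -/
def const (a : A) : Complexification A := ⟨a, 0⟩

/-- The complex conjugation `a + ιb ↦ a - ιb`. -/
def conj (w : Complexification A) : Complexification A := ⟨w.re, -w.im⟩

/-- The `*`-involution `(a + ιb)ᶜ = aᶜ + ιbᶜ`. -/
instance : Star (Complexification A) := ⟨fun w => ⟨star w.re, star w.im⟩⟩

/-- The map `a + ιb ↦ a + Jb`. -/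
def eval (J : A) (w : Complexification A) : A := w.re + J * w.im

/-- Powers with natural exponent. -/
def npow (w : Complexification A) : ℕ → Complexification A
  | 0 => const 1
  | n + 1 => w * npow w n

/-- The inverse `N⁻¹ wᶜ` of `w`, where `N = w wᶜ = c + ιd`. For `A = ℂ, ℍ, 𝕆` the elements `c`, `d`
are real, so that `N⁻¹ = (c² + d²)⁻¹ (c - ιd)`, and `c² + d² = ‖c * c + d * d‖`.
The value is junk when `c² + d² = 0`, that is, when `w` is not invertible. -/
noncomputable def inv (w : Complexification A) : Complexification A :=
  let N := w * star w
  let u := conj N * star w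
  let s : ℝ := ‖N.re * N.re + N.im * N.im‖⁻¹
  ⟨s • u.re, s • u.im⟩

/-- Powers with integer exponent. -/
noncomputable def zpow (w : Complexification A) : ℤ → Complexification A
  | Int.ofNat n => npow w n
  | Int.negSucc n => npow (inv w) (n + 1)

end Complexification

namespace SliceRegular

variable {A : Type*} [NonAssocNormedRing A] [StarRing A] [NormedSpace ℝ A]

/-! ### Circular sets, slice domains, product domains -/

/-- The sphere `𝕊` of imaginary units: `t(J) = 0` and `n(J) = 1`. -/
def imUnits (A : Type*) [NonAssocNormedRing A] [StarRing A] : Set A :=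
  {J | J + star J = 0 ∧ J * star J = 1}

/-- The map `φ_J : α + iβ ↦ α + βJ`. -/
def phi {A : Type*} [NonAssocNormedRing A] [NormedSpace ℝ A] (J : A) (z : ℂ) : A := z.re • (1 : A) + z.im • J

/-- The circularization `Ω_E` in `A` of a set `E` of complex numbers. -/
def circularization (A : Type*) [NonAssocNormedRing A] [StarRing A] [NormedSpace ℝ A]
    (E : Set ℂ) : Set A :=
  {x | ∃ z ∈ E, ∃ J ∈ imUnits A, x = phi J z}

/-- Circular sets. -/
def IsCircular (U : Set A) : Prop := ∃ E : Set ℂ, U = circularization A E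

/-- The conjugation-invariant set `D` of complex numbers such that `U = Ω_D`, if `U` is circular. -/
def profile (U : Set A) : Set ℂ := {z | ∃ J ∈ imUnits A, phi J z ∈ U}

/-- `Ω = Ω_D` with `D` open, connected, conjugation-invariant and meeting the real line. -/
def IsSliceDomain (Ω : Set A) : Prop :=
  ∃ D : Set ℂ, IsOpen D ∧ IsConnected D ∧ (∀ z ∈ D, star z ∈ D) ∧ (∃ r : ℝ, (r : ℂ) ∈ D) ∧
    Ω = circularization A D

/-- `Ω = Ω_D` with `D` open, not meeting the real line, and having exactly two connected components,
which are switched by complex conjugation. -/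
def IsProductDomain (Ω : Set A) : Prop :=
  ∃ D : Set ℂ, IsOpen D ∧ (∀ r : ℝ, (r : ℂ) ∉ D) ∧
    (∃ z ∈ D, star z ∈ D ∧
      D = connectedComponentIn D z ∪ connectedComponentIn D (star z) ∧
      Disjoint (connectedComponentIn D z) (connectedComponentIn D (star z)) ∧
      star '' connectedComponentIn D z = connectedComponentIn D (star z)) ∧
    Ω = circularization A D

/-! ### Slice functions and slice regular functions

A function on a circular set `U` is represented by a function `A → A`; its values outside `U` play
no role. -/

/-- `F` is a stem function on `D`: `F(z̄)` is the complex conjugate of `F(z)`. -/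
def IsStem (D : Set ℂ) (F : ℂ → Complexification A) : Prop :=
  ∀ z ∈ D, F (star z) = (F z).conj

/-- On `U`, the function `f` is the slice function induced by the stem function `F = F₁ + ιF₂`, that
is, `f(α + βJ) = F₁(α + iβ) + J F₂(α + iβ)`. -/
def IsInducedBy (U : Set A) (F : ℂ → Complexification A) (f : A → A) : Prop :=
  IsStem (profile U) F ∧
    ∀ z : ℂ, ∀ J ∈ imUnits A, phi J z ∈ U → f (phi J z) = (F z).eval J

/-- `F = F₁ + ιF₂` is holomorphic at every point of `D` (Cauchy-Riemann equations
`∂F₁/∂α = ∂F₂/∂β` and `∂F₁/∂β = -∂F₂/∂α`). -/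
def IsHolomorphicStem (D : Set ℂ) (F : ℂ → Complexification A) : Prop :=
  ∀ z ∈ D, ∃ L₁ L₂ : ℂ →L[ℝ] A,
    HasFDerivAt (fun w => (F w).re) L₁ z ∧ HasFDerivAt (fun w => (F w).im) L₂ z ∧
      L₁ 1 = L₂ Complex.I ∧ L₁ Complex.I = -L₂ 1

/-- `f` is slice regular on the circular open set `U`: it is induced on `U` by a holomorphic stem
function. -/
def IsSliceRegular (U : Set A) (f : A → A) : Prop :=
  IsOpen U ∧ IsCircular U ∧
    ∃ F : ℂ → Complexification A, IsInducedBy U F f ∧ IsHolomorphicStem (profile U) F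

/-- On `U`, the function `h` is the slice product `f · g`: if `F`, `G` induce `f`, `g`, then the
pointwise product `FG` induces `f · g`. -/
def IsSliceProduct (U : Set A) (f g h : A → A) : Prop :=
  ∃ F G : ℂ → Complexification A, IsInducedBy U F f ∧ IsInducedBy U G g ∧
    IsInducedBy U (fun z => F z * G z) h

/-- On `U`, the function `h` is the slice conjugate `fᶜ`: if `F` induces `f`, then `Fᶜ` induces
`fᶜ`. -/
def IsSliceConj (U : Set A) (f h : A → A) : Prop :=
  ∃ F : ℂ → Complexification A, IsInducedBy U F f ∧ IsInducedBy U (fun z => star (F z)) h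

/-! ### Singularities -/

/-- `x` and `y` lie in the same slice `ℂ_J`. -/
def SameSlice (x y : A) : Prop := ∃ J ∈ imUnits A, x ∈ Set.range (phi J) ∧ y ∈ Set.range (phi J)

/-- The real part, as an element of `A`. -/
noncomputable def rePart (x : A) : A := (2⁻¹ : ℝ) • (x + star x)

/-- The imaginary part. -/
noncomputable def imPart (x : A) : A := (2⁻¹ : ℝ) • (x - star x)

open Classical in
/-- The distance `σ`. -/
noncomputable def sigma (x y : A) : ℝ :=
  if SameSlice x y then ‖x - y‖
  else √(‖rePart x - rePart y‖ ^ 2 + (‖imPart x‖ + ‖imPart y‖) ^ 2)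

open Classical in
/-- The pseudodistance `τ`. -/
noncomputable def tau (x y : A) : ℝ :=
  if SameSlice x y then ‖x - y‖
  else √(‖rePart x - rePart y‖ ^ 2 + (‖imPart x‖ - ‖imPart y‖) ^ 2)

/-- The shell `Σ(y, R₁, R₂)`. -/
def shell (y : A) (R₁ R₂ : ℝ) : Set A := {x | R₁ < tau x y ∧ sigma x y < R₂}

/-- `y` is a singularity for functions defined on `U`. -/
def IsSingularPoint (U : Set A) (y : A) : Prop := ∃ R : ℝ, 0 < R ∧ shell y 0 R ⊆ U

/-- The stem function `(α - y) + ιβ` of the binomial `x - y`. -/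
def binomialStem (y : A) (z : ℂ) : Complexification A := ⟨z.re • (1 : A) - y, z.im • (1 : A)⟩

/-- `f(x) = ∑ₙ (x - y)^{•n} · aₙ` (sum over the integers) at every point `x` of `V`. -/
def HasLaurentExpansion (V : Set A) (f : A → A) (y : A) (a : ℤ → A) : Prop :=
  ∀ z : ℂ, ∀ J ∈ imUnits A, phi J z ∈ V →
    HasSum (fun n : ℤ => ((binomialStem y z).zpow n * Complexification.const (a n)).eval J)
      (f (phi J z))

/-- `y` is a pole for `f`, a function on `U`: it is a singularity, and the expansion of `f` in some
shell `Σ(y, 0, R)` has only finitely many nonzero coefficients of negative index. -/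
def IsPole (U : Set A) (f : A → A) (y : A) : Prop :=
  ∃ R : ℝ, 0 < R ∧ shell y 0 R ⊆ U ∧
    ∃ a : ℤ → A, HasLaurentExpansion (shell y 0 R) f y a ∧
      ∃ m : ℕ, ∀ n : ℤ, n < -(m : ℤ) → a n = 0

/-- `y` is a removable singularity for `f`, a function on `U`: it is a singularity, and `f` extends
to a slice regular function on a circular open set containing `y`. -/
def IsRemovable (U : Set A) (f : A → A) (y : A) : Prop :=
  IsSingularPoint U y ∧
    ∃ (V : Set A) (g : A → A), U ⊆ V ∧ y ∈ V ∧ IsSliceRegular V g ∧ Set.EqOn g f U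

/-! ### Semiregular functions -/

/-- The semiregular functions on a circular open set `Ω`: slice regular functions on a circular open
subset `dom` such that every point of `Ω \ dom` is a pole or a removable singularity. -/
structure SemiregularFun (Ω : Set A) where
  dom : Set A
  toFun : A → A
  dom_subset : dom ⊆ Ω
  regular : IsSliceRegular dom toFun
  singular : ∀ y ∈ Ω \ dom, IsPole dom toFun y ∨ IsRemovable dom toFun y

theorem SemiregularFun.isSingularPoint {Ω : Set A} (f : SemiregularFun Ω) {y : A}
    (hy : y ∈ Ω \ f.dom) : IsSingularPoint f.dom y := by
  rcases f.singular y hy with ⟨R, hR, hs, -⟩ | h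
  · exact ⟨R, hR, hs⟩
  · exact h.1

theorem continuous_phi {B : Type*} [NonAssocNormedRing B] [NormedSpace ℝ B] (J : B) :
    Continuous (phi J) := by
  unfold phi
  have h1 := Complex.continuous_re
  have h2 := Complex.continuous_im
  fun_prop

theorem IsSliceRegular.continuousAt_comp_phi {U : Set A} {f : A → A} (h : IsSliceRegular U f)
    {J : A} (hJ : J ∈ imUnits A) {z : ℂ} (hz : phi J z ∈ U) :
    ContinuousAt (fun w => f (phi J w)) z := by
  obtain ⟨ho, -, F, hF, hol⟩ := h
  obtain ⟨L₁, L₂, h1, h2, -⟩ := hol z ⟨J, hJ, hz⟩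
  have hc : ContinuousAt (fun w => (F w).re + J * (F w).im) z :=
    h1.continuousAt.add (continuousAt_const.mul h2.continuousAt)
  refine hc.congr ?_
  filter_upwards [(continuous_phi J).continuousAt.preimage_mem_nhds (ho.mem_nhds hz)] with w hw
  exact (hF.2 w J hJ hw).symm

/-- Two semiregular functions on `Ω` are identified if they coincide on their common domain. -/
instance semiregularSetoid (Ω : Set A) : Setoid (SemiregularFun Ω) where
  r f g := Set.EqOn f.toFun g.toFun (f.dom ∩ g.dom)
  iseqv :=
    { refl := fun f x _ => rfl
      symm := fun {f g} h x hx => (h ⟨hx.2, hx.1⟩).symm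
      trans := by
        intro f g h hfg hgh x hx
        by_cases hxg : x ∈ g.dom
        · exact (hfg ⟨hx.1, hxg⟩).trans (hgh ⟨hxg, hx.2⟩)
        rcases subsingleton_or_nontrivial A with hA | hA
        · exact Subsingleton.elim _ _
        obtain ⟨R, hR, hsub⟩ := g.isSingularPoint ⟨f.dom_subset hx.1, hxg⟩
        obtain ⟨E, hE⟩ := f.regular.2.1
        obtain ⟨z, -, J, hJ, rfl⟩ : x ∈ circularization A E := hE ▸ hx.1
        have hone : 0 < ‖(1 : A)‖ := norm_pos_iff.2 one_ne_zero
        let c : ℝ → ℂ := fun t => z + t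
        have hc : Continuous c := by fun_prop
        have hc0 : c 0 = z := by simp [c]
        have hcf : ContinuousAt (fun t => f.toFun (phi J (c t))) 0 :=
          ContinuousAt.comp (g := fun w => f.toFun (phi J w))
            (by rw [hc0]; exact f.regular.continuousAt_comp_phi hJ hx.1) hc.continuousAt
        have hch : ContinuousAt (fun t => h.toFun (phi J (c t))) 0 :=
          ContinuousAt.comp (g := fun w => h.toFun (phi J w))
            (by rw [hc0]; exact h.regular.continuousAt_comp_phi hJ hx.2) hc.continuousAt
        have hph : Continuous fun t => phi J (c t) := (continuous_phi J).comp hc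
        have hmem : ∀ U : Set A, IsOpen U → phi J z ∈ U → ∀ᶠ t in 𝓝 (0 : ℝ), phi J (c t) ∈ U :=
          fun U hU hz => hph.continuousAt.preimage_mem_nhds (hU.mem_nhds (by rwa [hc0]))
        have hdist : ∀ t, phi J (c t) - phi J z = t • (1 : A) := by
          intro t; simp [c, phi, add_smul]
        have hsame : ∀ t, SameSlice (phi J (c t)) (phi J z) :=
          fun t => ⟨J, hJ, ⟨_, rfl⟩, ⟨_, rfl⟩⟩
        have hsmall : ∀ᶠ t in 𝓝 (0 : ℝ), ‖t • (1 : A)‖ < R := by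
          have hcont : Continuous fun t : ℝ => ‖t • (1 : A)‖ := by fun_prop
          exact hcont.continuousAt.eventually_lt continuousAt_const (by simpa using hR)
        have heq : ∀ᶠ t in 𝓝[≠] (0 : ℝ), f.toFun (phi J (c t)) = h.toFun (phi J (c t)) := by
          filter_upwards [self_mem_nhdsWithin,
            nhdsWithin_le_nhds (hmem _ f.regular.1 hx.1),
            nhdsWithin_le_nhds (hmem _ h.regular.1 hx.2),
            nhdsWithin_le_nhds hsmall] with t ht h1 h2 h3
          have hg : phi J (c t) ∈ g.dom := by
            apply hsub
            constructor
            · rw [tau, if_pos (hsame t), hdist, norm_smul]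
              exact mul_pos (norm_pos_iff.2 ht) hone
            · rwa [sigma, if_pos (hsame t), hdist]
          exact (hfg ⟨h1, hg⟩).trans (hgh ⟨hg, h2⟩)
        have l1 := hcf.tendsto.mono_left (nhdsWithin_le_nhds (s := {0}ᶜ))
        have l2 := hch.tendsto.mono_left (nhdsWithin_le_nhds (s := {0}ᶜ))
        have := tendsto_nhds_unique (l1.congr' heq) l2
        simpa [hc0] using this }

/-- The set `SEM(Ω)` of semiregular functions on `Ω`, two of them being identified if they coincide
on their common domain. -/
def SEM (Ω : Set A) : Type _ := Quotient (semiregularSetoid Ω)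

/-- The element of `SEM(Ω)` given by a semiregular function. -/
def SEM.mk {Ω : Set A} (f : SemiregularFun Ω) : SEM Ω := Quotient.mk _ f

/-- A (not necessarily associative) unital division algebra: a nonzero algebra in which every nonzero
`a` has a two-sided inverse and all equations `a x = b` and `x a = b` are uniquely solvable. -/
def IsDivisionAlgebra (R : Type*) [NonAssocRing R] : Prop :=
  Nontrivial R ∧ ∀ a : R, a ≠ 0 →
    (∃ b : R, a * b = 1 ∧ b * a = 1) ∧
      Function.Bijective (fun x : R => a * x) ∧ Function.Bijective (fun x : R => x * a)

end SliceRegular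

open SliceRegular

/-! ### The common properties of `ℂ`, `ℍ`, `𝕆` -/

/-! The three algebras share a short list of properties: they are finite-dimensional and
alternative, and `x + xᶜ` and `x xᶜ = |x|²` are real. Everything else uses only this list. The
complexification `A ⊗ ℂ` is then again an alternative `*`-algebra, and `w wᶜ = n(w)` is a complex
scalar. Since `wᶜ` is a scalar minus `w`, alternativity makes multiplication by `n(w)⁻¹ wᶜ` inverse
to multiplication by `w`, on either side, as soon as `n(w) ≠ 0`.

A slice function determines its stem function, so the algebra takes place pointwise in `A ⊗ ℂ`. The
analytic core is a description of semiregularity in terms of the stem: it is holomorphic off a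
discrete set and of polynomial growth at the missing points. A pole or a removable singularity
forces such growth (`meromorphicStemAt_of_singular`). Conversely, growth makes the coordinates of
the stem meromorphic, and their scalar Laurent series assemble into the slice expansion
(`isPole_of_meromorphicStemAt`). Growth conditions are visibly stable under sums, products,
conjugates and multiplication by meromorphic scalars. Hence `SEM Ω` embeds in the germs of `A ⊗
ℂ`-valued functions along complements of discrete sets (`SEM.germ_injective`), and all identities
are inherited pointwise.

For a stem `F` the inverse `n(F)⁻¹ Fᶜ` exists unless the scalar meromorphic function `n(F)` vanishes
identically near some point. On a slice domain this vanishing would spread by connectedness to a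
real point. On the real axis `F₂ = 0` and `n(F) = |F₁|²`, so `F` would vanish there, and by the
identity theorem everywhere. On a product domain the vanishing spreads over one component and passes
to the other by conjugation, so that `N(f) = 0`. There is no real axis to prevent this: the locally
constant stem equal to `1 + ιJ` on one component and `1 - ιJ` on the other is nonzero and has `n =
0`. -/

/-- The properties shared by the real `*`-algebras `ℂ`, `ℍ` and `𝕆`. -/
class IsHypercomplex (A : Type*) [NonAssocNormedRing A] [StarRing A] [NormedSpace ℝ A] : Prop where
  nontrivial : Nontrivial A
  finiteDimensional : FiniteDimensional ℝ A
  smul_mul (r : ℝ) (x y : A) : (r • x) * y = r • (x * y)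
  mul_smul (r : ℝ) (x y : A) : x * (r • y) = r • (x * y)
  star_smul (r : ℝ) (x : A) : star (r • x) = r • star x
  left_alt (x y : A) : (x * x) * y = x * (x * y)
  right_alt (x y : A) : (x * y) * y = x * (y * y)
  add_star (x : A) : ∃ r : ℝ, x + star x = r • (1 : A)
  mul_star (x : A) : x * star x = (‖x‖ ^ 2) • (1 : A)
  exists_imUnit : (imUnits A).Nonempty

theorem isHypercomplex_complex : IsHypercomplex ℂ where
  nontrivial := inferInstance
  finiteDimensional := inferInstance
  smul_mul r x y := smul_mul_assoc r x y
  mul_smul r x y := mul_smul_comm r x y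
  star_smul r x := by simp
  left_alt x y := mul_assoc x x y
  right_alt x y := mul_assoc x y y
  add_star x := ⟨2 * x.re, by apply Complex.ext <;> simp; ring⟩
  mul_star x := by
    rw [Complex.star_def, Complex.mul_conj, Complex.normSq_eq_norm_sq]; simp
  exists_imUnit := ⟨Complex.I, by simp [imUnits]⟩

theorem Quaternion.self_mul_star_eq_smul (q : ℍ[ℝ]) : q * star q = (‖q‖ ^ 2) • (1 : ℍ[ℝ]) := by
  rw [Quaternion.self_mul_star, Quaternion.normSq_eq_norm_mul_self, ← sq,
    ← Quaternion.coe_mul_eq_smul, mul_one]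

theorem Quaternion.star_mul_self_eq_smul (q : ℍ[ℝ]) : star q * q = (‖q‖ ^ 2) • (1 : ℍ[ℝ]) := by
  rw [Quaternion.star_mul_self, Quaternion.normSq_eq_norm_mul_self, ← sq,
    ← Quaternion.coe_mul_eq_smul, mul_one]

theorem isHypercomplex_quaternion : IsHypercomplex ℍ[ℝ] where
  nontrivial := inferInstance
  finiteDimensional := inferInstance
  smul_mul r x y := smul_mul_assoc r x y
  mul_smul r x y := mul_smul_comm r x y
  star_smul r x := by simp
  left_alt x y := mul_assoc x x y
  right_alt x y := mul_assoc x y y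
  add_star x := ⟨2 * x.re, by ext <;> simp; ring⟩
  mul_star := Quaternion.self_mul_star_eq_smul
  exists_imUnit := by
    obtain ⟨J, h⟩ : ∃ J : ℍ[ℝ], J.re = 0 ∧ J.imI = 1 ∧ J.imJ = 0 ∧ J.imK = 0 :=
      ⟨⟨0, 1, 0, 0⟩, rfl, rfl, rfl, rfl⟩
    have h1 : J + star J = 0 := by ext <;> simp [h]
    have h2 : J * star J = 1 := by ext <;> simp [h]
    exact ⟨J, h1, h2⟩

/-- The linear equivalence of the octonions with pairs of quaternions. -/
noncomputable def Octonion.linearEquivProd : Octonion ≃ₗ[ℝ] ℍ[ℝ] × ℍ[ℝ] where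
  toFun := Octonion.toProd
  invFun p := ⟨p.1, p.2⟩
  map_add' _ _ := rfl
  map_smul' _ _ := rfl
  left_inv _ := rfl
  right_inv _ := rfl

namespace Octonion

theorem smul_mul_octonion (r : ℝ) (x y : Octonion) : (r • x) * y = r • (x * y) := by
  ext1 <;> simp [smul_sub]

theorem mul_smul_octonion (r : ℝ) (x y : Octonion) : x * (r • y) = r • (x * y) := by
  ext1 <;> simp [smul_sub]

theorem add_star (x : Octonion) : x + star x = (2 * x.fst.re) • (1 : Octonion) := by
  ext1
  · simp only [fst_add, fst_star, fst_smul, fst_one]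
    rw [Quaternion.self_add_star', ← Quaternion.coe_mul_eq_smul, mul_one]
  · simp

/-- Both alternative laws come from this identity: `xᶜ` is a real number minus `x`, so cancelling
`xᶜ` against `x` amounts to associating `x` with `x`. In coordinates associativity of the
quaternions cancels the mixed terms and leaves the real factors `|α|²` and `|β|²`. -/
theorem star_mul_mul (x y : Octonion) : star x * (x * y) = (‖x‖ ^ 2) • y := by
  have hs := Quaternion.self_mul_star_eq_smul
  have hs' := Quaternion.star_mul_self_eq_smul
  rw [norm_sq, add_smul]
  ext1
  · simp only [fst_mul, fst_star, snd_mul, snd_star, fst_add, fst_smul, mul_sub, star_neg,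
      mul_neg, add_mul]
    rw [← mul_assoc (star x.fst), hs', mul_assoc y.fst, hs]
    simp only [smul_mul_assoc, one_mul, mul_smul_comm, mul_one]
    noncomm_ring
  · simp only [fst_mul, fst_star, snd_mul, snd_star, snd_add, snd_smul, mul_add, star_star,
      mul_neg, sub_mul]
    rw [← mul_assoc x.fst (star x.fst), hs, mul_assoc y.snd, hs']
    simp only [smul_mul_assoc, one_mul, mul_smul_comm, mul_one]
    noncomm_ring

theorem star_smul_octonion (r : ℝ) (x : Octonion) : star (r • x) = r • star x := by
  ext1 <;> simp

theorem star_mul_self (x : Octonion) : star x * x = (‖x‖ ^ 2) • (1 : Octonion) := by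
  simpa using star_mul_mul x 1

theorem norm_star (x : Octonion) : ‖star x‖ = ‖x‖ := by
  rw [norm_def, norm_def]; simp

/-- The mirror image of `star_mul_mul` under the anti-automorphism `star`. -/
theorem mul_mul_star (x y : Octonion) : (y * x) * star x = (‖x‖ ^ 2) • y := by
  have h := congrArg star (star_mul_mul (star x) (star y))
  simpa [norm_star, star_smul_octonion] using h

theorem left_alt (x y : Octonion) : (x * x) * y = x * (x * y) := by
  have h : x = (2 * x.fst.re) • (1 : Octonion) - star x := by rw [← add_star]; abel
  calc (x * x) * y = (((2 * x.fst.re) • (1 : Octonion) - star x) * x) * y := by rw [← h]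
    _ = ((2 * x.fst.re) • (1 : Octonion) - star x) * (x * y) := by
      simp only [sub_mul, star_mul_self, smul_mul_octonion, one_mul, star_mul_mul]
    _ = x * (x * y) := by rw [← h]

theorem right_alt (x y : Octonion) : (x * y) * y = x * (y * y) := by
  have h : y = (2 * y.fst.re) • (1 : Octonion) - star y := by rw [← add_star]; abel
  have h2 : y * star y = (‖y‖ ^ 2) • (1 : Octonion) := by simpa using mul_mul_star y 1
  calc (x * y) * y = (x * y) * ((2 * y.fst.re) • (1 : Octonion) - star y) := by rw [← h]
    _ = x * (y * ((2 * y.fst.re) • (1 : Octonion) - star y)) := by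
      simp only [mul_sub, h2, mul_smul_octonion, mul_one, mul_mul_star]
    _ = x * (y * y) := by rw [← h]

end Octonion

theorem isHypercomplex_octonion : IsHypercomplex Octonion where
  nontrivial := ⟨0, 1, fun h => by
    have := congrArg (fun x : Octonion => x.fst) h
    simp at this⟩
  finiteDimensional := Module.Finite.equiv Octonion.linearEquivProd.symm
  smul_mul := Octonion.smul_mul_octonion
  mul_smul := Octonion.mul_smul_octonion
  star_smul := Octonion.star_smul_octonion
  left_alt := Octonion.left_alt
  right_alt := Octonion.right_alt
  add_star x := ⟨_, Octonion.add_star x⟩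
  mul_star x := by simpa using Octonion.mul_mul_star x 1
  exists_imUnit := by
    let J : Octonion := ⟨0, 1⟩
    have h1 : J + star J = 0 := by ext1 <;> simp [J]
    have h2 : J * star J = 1 := by ext1 <;> simp [J]
    exact ⟨J, h1, h2⟩

instance isHypercomplex_carrier : (k : HypercomplexType) → IsHypercomplex k.Carrier
  | .complex => isHypercomplex_complex
  | .quaternion => isHypercomplex_quaternion
  | .octonion => isHypercomplex_octonion

/-! ### Alternative algebras -/

section Alternative

variable {R : Type*} [NonAssocRing R]

/-- Expanding the law at `a + b` and cancelling the diagonal terms. The linearised law handles the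
cross terms when the alternative laws pass to the complexification. -/
theorem left_alt_polarized (h : ∀ x y : R, (x * x) * y = x * (x * y)) (a b c : R) :
    (a * b) * c + (b * a) * c = a * (b * c) + b * (a * c) := by
  have h1 := h (a + b) c
  simp only [add_mul, mul_add, h] at h1
  have h2 := sub_eq_zero.2 h1
  rw [← sub_eq_zero, ← h2]
  abel

theorem right_alt_polarized (h : ∀ x y : R, (x * y) * y = x * (y * y)) (a b c : R) :
    (a * b) * c + (a * c) * b = a * (b * c) + a * (c * b) := by
  have h1 := h a (b + c)
  simp only [add_mul, mul_add, h] at h1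
  have h2 := sub_eq_zero.2 h1
  rw [← sub_eq_zero, ← h2]
  abel

/-- The remaining case of the vanishing associator: the linearised right law at `(a, b, a)`, minus
the left law for `(a, a, b)`. -/
theorem flexible_of_alt (h : ∀ x y : R, (x * x) * y = x * (x * y))
    (h' : ∀ x y : R, (x * y) * y = x * (y * y)) (a b : R) : (a * b) * a = a * (b * a) := by
  have := right_alt_polarized h' a b a
  rw [h] at this
  exact add_right_cancel this

end Alternative

/-! ### Real part, norm and conjugation in the algebra `A`. -/

namespace IsHypercomplex

variable {A : Type*} [NonAssocNormedRing A] [StarRing A] [NormedSpace ℝ A] [IsHypercomplex A]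

instance : IsScalarTower ℝ A A := ⟨fun r x y => smul_mul r x y⟩
instance : SMulCommClass ℝ A A := ⟨fun r x y => (mul_smul r x y).symm⟩
instance : StarModule ℝ A := ⟨star_smul⟩

variable (A) in
theorem one_ne_zero' : (1 : A) ≠ 0 := by
  have := IsHypercomplex.nontrivial (A := A)
  exact one_ne_zero

theorem smul_one_inj {r s : ℝ} : r • (1 : A) = s • (1 : A) ↔ r = s := by
  refine ⟨fun h => ?_, fun h => h ▸ rfl⟩
  exact smul_left_injective ℝ (one_ne_zero' A) h

theorem norm_one : ‖(1 : A)‖ = 1 := by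
  have h := mul_star (1 : A)
  rw [star_one, mul_one] at h
  have h2 : (1 : ℝ) • (1 : A) = (‖(1 : A)‖ ^ 2) • 1 := by rw [one_smul]; exact h
  rw [smul_one_inj] at h2
  nlinarith [norm_nonneg (1 : A)]

/-- `xᶜ` is a real number minus `x`, hence commutes with `x`. -/
theorem star_mul_self (x : A) : star x * x = (‖x‖ ^ 2) • (1 : A) := by
  obtain ⟨r, hr⟩ := add_star x
  rw [← mul_star x, eq_sub_of_add_eq' hr, sub_mul, mul_sub]
  simp

theorem norm_star (x : A) : ‖star x‖ = ‖x‖ := by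
  have h := star_mul_self (star x)
  rw [star_star, mul_star, smul_one_inj] at h
  exact ((sq_eq_sq₀ (norm_nonneg _) (norm_nonneg _)).1 h).symm

/-- The real part as a real number. -/
noncomputable def re : A →ₗ[ℝ] ℝ where
  -- The real number `r` with `x + xᶜ = r` is unique because `1 ≠ 0`; this uniqueness makes the
  -- chosen value linear in `x`.
  toFun x := 2⁻¹ * (add_star x).choose
  map_add' x y := by
    rw [← mul_add]; congr 1
    rw [← smul_one_inj (A := A), ← (add_star (x + y)).choose_spec, add_smul,
      ← (add_star x).choose_spec, ← (add_star y).choose_spec, star_add]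
    abel
  map_smul' r x := by
    rw [RingHom.id_apply, smul_eq_mul, mul_left_comm]; congr 1
    rw [← smul_one_inj (A := A), ← (add_star (r • x)).choose_spec, SemigroupAction.mul_smul,
      ← (add_star x).choose_spec, star_smul, smul_add]

theorem add_star_eq (x : A) : x + star x = (2 * re x) • (1 : A) := by
  rw [(add_star x).choose_spec]; simp [re]

@[simp] theorem re_one : re (1 : A) = 1 := by
  have h := add_star_eq (1 : A)
  rw [star_one, ← two_smul ℝ (1 : A), smul_one_inj] at h
  linarith

theorem rePart_eq (x : A) : rePart x = re x • (1 : A) := by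
  rw [rePart, add_star_eq, smul_smul]; congr 1; ring

theorem star_eq (x : A) : star x = (2 * re x) • (1 : A) - x := by
  rw [← add_star_eq]; abel

variable (A) in
theorem continuous_re : Continuous (re : A →ₗ[ℝ] ℝ) :=
  have := finiteDimensional (A := A)
  LinearMap.continuous_of_finiteDimensional _

theorem continuous_star : Continuous (star : A → A) := by
  have h : (star : A → A) = fun x => (2 * re x) • (1 : A) - x := funext star_eq
  rw [h]
  have := continuous_re A
  fun_prop

theorem mul_star_add_mul_star (a b : A) :
    a * star b + b * star a = (2 * re (a * star b)) • (1 : A) := by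
  rw [← add_star_eq, star_mul, star_star]

end IsHypercomplex

/-! ### Algebra of the complexification -/

namespace Complexification

section Ring

variable {A : Type*} [NonAssocNormedRing A]

instance : Zero (Complexification A) := ⟨⟨0, 0⟩⟩
instance : One (Complexification A) := ⟨⟨1, 0⟩⟩
instance : Add (Complexification A) := ⟨fun v w => ⟨v.re + w.re, v.im + w.im⟩⟩
instance : Neg (Complexification A) := ⟨fun w => ⟨-w.re, -w.im⟩⟩
instance : Sub (Complexification A) := ⟨fun v w => ⟨v.re - w.re, v.im - w.im⟩⟩
instance : SMul ℕ (Complexification A) := ⟨fun n w => ⟨n • w.re, n • w.im⟩⟩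
instance : SMul ℤ (Complexification A) := ⟨fun n w => ⟨n • w.re, n • w.im⟩⟩

@[simp] theorem zero_re : (0 : Complexification A).re = 0 := rfl
@[simp] theorem zero_im : (0 : Complexification A).im = 0 := rfl
@[simp] theorem one_re : (1 : Complexification A).re = 1 := rfl
@[simp] theorem one_im : (1 : Complexification A).im = 0 := rfl
@[simp] theorem add_re (v w : Complexification A) : (v + w).re = v.re + w.re := rfl
@[simp] theorem add_im (v w : Complexification A) : (v + w).im = v.im + w.im := rfl
@[simp] theorem neg_re (w : Complexification A) : (-w).re = -w.re := rfl
@[simp] theorem neg_im (w : Complexification A) : (-w).im = -w.im := rfl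
@[simp] theorem sub_re (v w : Complexification A) : (v - w).re = v.re - w.re := rfl
@[simp] theorem sub_im (v w : Complexification A) : (v - w).im = v.im - w.im := rfl
@[simp] theorem mul_re (v w : Complexification A) : (v * w).re = v.re * w.re - v.im * w.im := rfl
@[simp] theorem mul_im (v w : Complexification A) : (v * w).im = v.re * w.im + v.im * w.re := rfl
@[simp] theorem const_re (a : A) : (const a).re = a := rfl
@[simp] theorem const_im (a : A) : (const a).im = 0 := rfl
@[simp] theorem conj_re (w : Complexification A) : w.conj.re = w.re := rfl
@[simp] theorem conj_im (w : Complexification A) : w.conj.im = -w.im := rfl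
@[simp] theorem star_re [StarRing A] (w : Complexification A) : (star w).re = star w.re := rfl
@[simp] theorem star_im [StarRing A] (w : Complexification A) : (star w).im = star w.im := rfl

theorem const_one : const (1 : A) = 1 := rfl

/-- The pair of components. -/
def toProd (w : Complexification A) : A × A := (w.re, w.im)

omit [NonAssocNormedRing A] in
theorem toProd_injective : Function.Injective (toProd (A := A)) := fun x y h => by
  simp only [toProd, Prod.mk.injEq] at h
  exact Complexification.ext h.1 h.2

instance : AddCommGroup (Complexification A) :=
  toProd_injective.addCommGroup toProd rfl (fun _ _ => rfl) (fun _ => rfl) (fun _ _ => rfl)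
    (fun _ _ => rfl) (fun _ _ => rfl)

instance : NonAssocRing (Complexification A) :=
  { (inferInstance : AddCommGroup (Complexification A)),
    (inferInstance : Mul (Complexification A)), (inferInstance : One (Complexification A)) with
    left_distrib := fun x y z => by ext1 <;> simp [mul_add] <;> abel
    right_distrib := fun x y z => by ext1 <;> simp [add_mul] <;> abel
    zero_mul := fun x => by ext1 <;> simp
    mul_zero := fun x => by ext1 <;> simp
    one_mul := fun x => by ext1 <;> simp
    mul_one := fun x => by ext1 <;> simp }

instance [StarRing A] : StarRing (Complexification A) where
  star_involutive x := by ext1 <;> simp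
  star_mul x y := by ext1 <;> simp [add_comm]
  star_add x y := by ext1 <;> simp

theorem conj_add (v w : Complexification A) : (v + w).conj = v.conj + w.conj := by
  ext1 <;> simp [add_comm]

theorem conj_mul (v w : Complexification A) : (v * w).conj = v.conj * w.conj := by
  ext1 <;> simp [add_comm]

theorem conj_star [StarRing A] (w : Complexification A) : (star w).conj = star w.conj := by
  ext1 <;> simp

@[simp] theorem conj_conj (w : Complexification A) : w.conj.conj = w := by
  ext1 <;> simp

theorem eval_add (J : A) (v w : Complexification A) : (v + w).eval J = v.eval J + w.eval J := by
  simp only [eval, add_re, add_im, mul_add]; abel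

/-- The pairs `(z, J)` and `(z̄, -J)` describe the same point of `A`; this invariance makes induced
slice functions well defined. -/
theorem eval_conj (J : A) (w : Complexification A) : w.conj.eval (-J) = w.eval J := by
  simp [eval]

@[simp] theorem eval_const (J a : A) : (const a).eval J = a := by simp [eval]

end Ring

section Module

variable {A : Type*} [NonAssocNormedRing A] [NormedSpace ℝ A]

instance : SMul ℂ (Complexification A) :=
  ⟨fun c w => ⟨c.re • w.re - c.im • w.im, c.re • w.im + c.im • w.re⟩⟩

@[simp] theorem csmul_re (c : ℂ) (w : Complexification A) :
    (c • w).re = c.re • w.re - c.im • w.im := rfl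
@[simp] theorem csmul_im (c : ℂ) (w : Complexification A) :
    (c • w).im = c.re • w.im + c.im • w.re := rfl

instance : Module ℂ (Complexification A) where
  one_smul x := by ext1 <;> simp
  mul_smul r s x := by ext1 <;> simp [mul_smul, sub_smul, add_smul, smul_sub] <;> abel
  smul_zero r := by ext1 <;> simp
  smul_add r x y := by ext1 <;> simp <;> abel
  add_smul r s x := by ext1 <;> simp [add_smul] <;> abel
  zero_smul x := by ext1 <;> simp

@[simp] theorem rsmul_re (r : ℝ) (w : Complexification A) : (r • w).re = r • w.re := by
  change ((r : ℂ) • w).re = _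
  rw [csmul_re]
  simp

@[simp] theorem rsmul_im (r : ℝ) (w : Complexification A) : (r • w).im = r • w.im := by
  change ((r : ℂ) • w).im = _
  rw [csmul_im]
  simp

end Module

section Hypercomplex

variable {A : Type*} [NonAssocNormedRing A] [StarRing A] [NormedSpace ℝ A] [IsHypercomplex A]

theorem rsmul_mul (r : ℝ) (v w : Complexification A) : (r • v) * w = r • (v * w) := by
  ext1 <;> simp [smul_sub, smul_mul_assoc]

theorem mul_rsmul (r : ℝ) (v w : Complexification A) : v * (r • w) = r • (v * w) := by
  ext1 <;> simp [smul_sub, mul_smul_comm]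

theorem csmul_mul (c : ℂ) (v w : Complexification A) : (c • v) * w = c • (v * w) := by
  ext1 <;> simp [smul_sub, smul_mul_assoc, sub_mul, add_mul] <;> abel

theorem mul_csmul (c : ℂ) (v w : Complexification A) : v * (c • w) = c • (v * w) := by
  ext1 <;> simp [smul_sub, mul_smul_comm, mul_sub, mul_add] <;> abel

theorem star_rsmul (r : ℝ) (w : Complexification A) : star (r • w) = r • star w := by
  ext1 <;> simp

/-- The law is quadratic in `v = a + ιb`: the pure terms obey the law in `A`, and the cross terms
obey its linearisation at `a`, `b`. -/
theorem left_alt (v w : Complexification A) : (v * v) * w = v * (v * w) := by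
  have h := left_alt_polarized (R := A) IsHypercomplex.left_alt
  have h1 := h v.re v.im w.re
  have h2 := h v.re v.im w.im
  ext1
  · simp only [mul_re, mul_im, sub_mul, mul_sub, mul_add, IsHypercomplex.left_alt,
      add_mul, h2]
    abel
  · simp only [mul_re, mul_im, sub_mul, mul_sub, mul_add, IsHypercomplex.left_alt,
      add_mul, h1]
    abel

theorem right_alt (v w : Complexification A) : (v * w) * w = v * (w * w) := by
  have h := right_alt_polarized (R := A) IsHypercomplex.right_alt
  have h1 := h v.re w.re w.im
  have h2 := h v.im w.re w.im
  ext1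
  · simp only [mul_re, mul_im, sub_mul, mul_sub, mul_add, IsHypercomplex.right_alt,
      add_mul]
    rw [← sub_eq_zero] at h2 ⊢
    rw [← neg_eq_zero, ← h2]
    abel
  · simp only [mul_re, mul_im, sub_mul, mul_sub, mul_add, IsHypercomplex.right_alt,
      add_mul]
    rw [← sub_eq_zero] at h1 ⊢
    rw [← h1]
    abel

/-- The complex number `n(w)` such that `w wᶜ = n(w) · 1`. -/
noncomputable def normC (w : Complexification A) : ℂ :=
  ⟨‖w.re‖ ^ 2 - ‖w.im‖ ^ 2, 2 * IsHypercomplex.re (w.re * star w.im)⟩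

/-- The complex number `t(w)` such that `w + wᶜ = t(w) · 1`. -/
noncomputable def trC (w : Complexification A) : ℂ :=
  ⟨2 * IsHypercomplex.re w.re, 2 * IsHypercomplex.re w.im⟩

theorem mul_star_self (w : Complexification A) : w * star w = normC w • 1 := by
  ext1
  · simp [normC, IsHypercomplex.mul_star, sub_smul]
  · simp [normC, IsHypercomplex.mul_star_add_mul_star]

theorem star_eq_trC (w : Complexification A) : star w = trC w • 1 - w := by
  ext1 <;> simp [trC, IsHypercomplex.star_eq]

theorem star_mul_self (w : Complexification A) : star w * w = normC w • 1 := by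
  rw [← mul_star_self, star_eq_trC, sub_mul, mul_sub, csmul_mul, mul_csmul, one_mul, mul_one]

/-- Replacing `wᶜ` by a complex scalar minus `w` reduces re-association of `wᶜ`, `w`, `v` to the
alternative law. The three variants that follow use the same substitution. -/
theorem star_mul_mul (w v : Complexification A) : star w * (w * v) = normC w • v := by
  calc star w * (w * v) = (star w * w) * v := by
        rw [star_eq_trC, sub_mul, sub_mul, sub_mul, left_alt, csmul_mul, csmul_mul, csmul_mul,
          one_mul, one_mul]
    _ = normC w • v := by rw [star_mul_self, csmul_mul, one_mul]

theorem mul_star_mul (w v : Complexification A) : w * (star w * v) = normC w • v := by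
  calc w * (star w * v) = (w * star w) * v := by
        rw [star_eq_trC, sub_mul, mul_sub, mul_sub, sub_mul, left_alt, csmul_mul, mul_csmul,
          mul_csmul, csmul_mul, one_mul, mul_one]
    _ = normC w • v := by rw [mul_star_self, csmul_mul, one_mul]

theorem mul_mul_star (w v : Complexification A) : (v * w) * star w = normC w • v := by
  calc (v * w) * star w = v * (w * star w) := by
        rw [star_eq_trC, mul_sub, mul_sub, mul_sub, right_alt, mul_csmul, mul_csmul, mul_csmul,
          mul_one, mul_one]
    _ = normC w • v := by rw [mul_star_self, mul_csmul, mul_one]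

theorem mul_star_mul_self (w v : Complexification A) : (v * star w) * w = normC w • v := by
  calc (v * star w) * w = v * (star w * w) := by
        rw [star_eq_trC, mul_sub, sub_mul, sub_mul, mul_sub, right_alt, mul_csmul, csmul_mul,
          csmul_mul, mul_csmul, one_mul, mul_one]
    _ = normC w • v := by rw [star_mul_self, mul_csmul, mul_one]

theorem normC_conj (w : Complexification A) : normC w.conj = star (normC w) := by
  apply Complex.ext <;> simp [normC]

/-- `‖c² + d²‖` is `|n(w)|²`, and `n⁻¹ = n̄ / |n|²`. Since `0⁻¹ = 0`, both sides vanish when `n(w) =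
0`, so the formula holds for every `w`. -/
theorem inv_eq (w : Complexification A) : inv w = (normC w)⁻¹ • star w := by
  have h : ‖(w * star w).re * (w * star w).re + (w * star w).im * (w * star w).im‖ =
      Complex.normSq (normC w) := by
    rw [mul_star_self]
    simp only [csmul_re, csmul_im, one_re, one_im, smul_zero, sub_zero, zero_add,
      smul_mul_smul_comm, mul_one, ← add_smul, norm_smul, IsHypercomplex.norm_one]
    rw [Complex.normSq_apply, Real.norm_of_nonneg (add_nonneg (mul_self_nonneg _) (mul_self_nonneg _))]
  have h2 : conj (w * star w) * star w = (starRingEnd ℂ (normC w)) • star w := by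
    rw [mul_star_self]
    have : conj (normC w • (1 : Complexification A)) = (starRingEnd ℂ (normC w)) • 1 := by
      ext1 <;> simp
    rw [this, csmul_mul, one_mul]
  unfold inv
  simp only [h, h2]
  rw [Complex.inv_def, mul_comm, mul_smul, Complex.coe_smul]
  ext1 <;> simp

/-- Without associativity a two-sided inverse does not by itself solve `ax = b`. This law and its
three companions say that multiplications by `w` and by `n(w)⁻¹ wᶜ` undo each other, which does. -/
theorem inv_mul_cancel_left {w : Complexification A} (h : normC w ≠ 0) (v : Complexification A) :
    ((normC w)⁻¹ • star w) * (w * v) = v := by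
  rw [csmul_mul, star_mul_mul, smul_smul, inv_mul_cancel₀ h, one_smul]

theorem mul_inv_cancel_left {w : Complexification A} (h : normC w ≠ 0) (v : Complexification A) :
    w * (((normC w)⁻¹ • star w) * v) = v := by
  rw [csmul_mul, mul_csmul, mul_star_mul, smul_smul, inv_mul_cancel₀ h, one_smul]

theorem mul_inv_cancel_right {w : Complexification A} (h : normC w ≠ 0) (v : Complexification A) :
    (v * w) * ((normC w)⁻¹ • star w) = v := by
  rw [mul_csmul, mul_mul_star, smul_smul, inv_mul_cancel₀ h, one_smul]

theorem inv_mul_cancel_right {w : Complexification A} (h : normC w ≠ 0) (v : Complexification A) :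
    (v * ((normC w)⁻¹ • star w)) * w = v := by
  rw [mul_csmul, csmul_mul, mul_star_mul_self, smul_smul, inv_mul_cancel₀ h, one_smul]

end Hypercomplex

end Complexification

/-! ### Slices, circular sets, stem functions -/

namespace SliceRegular

set_option linter.unusedSectionVars false

variable {A : Type*} [NonAssocNormedRing A] [StarRing A] [NormedSpace ℝ A] [IsHypercomplex A]

open IsHypercomplex (re)

section Slices

theorem star_imUnit {J : A} (hJ : J ∈ imUnits A) : star J = -J :=
  eq_neg_of_add_eq_zero_right hJ.1

theorem imUnit_mul_self {J : A} (hJ : J ∈ imUnits A) : J * J = -1 := by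
  rw [← hJ.2, star_imUnit hJ, mul_neg, neg_neg]

theorem neg_mem_imUnits {J : A} (hJ : J ∈ imUnits A) : -J ∈ imUnits A := by
  refine ⟨?_, ?_⟩
  · rw [star_neg, ← neg_add, hJ.1, neg_zero]
  · rw [star_neg, neg_mul_neg, hJ.2]

theorem imUnit_mul_mul {J : A} (hJ : J ∈ imUnits A) (x : A) : J * (J * x) = -x := by
  rw [← IsHypercomplex.left_alt, imUnit_mul_self hJ, neg_one_mul]

theorem norm_imUnit {J : A} (hJ : J ∈ imUnits A) : ‖J‖ = 1 := by
  have h := IsHypercomplex.mul_star J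
  rw [hJ.2, ← one_smul ℝ (1 : A), smul_smul, mul_one, IsHypercomplex.smul_one_inj] at h
  nlinarith [norm_nonneg J]

theorem re_imUnit {J : A} (hJ : J ∈ imUnits A) : re J = 0 := by
  have h := IsHypercomplex.add_star_eq J
  rw [hJ.1, ← zero_smul ℝ (1 : A), IsHypercomplex.smul_one_inj] at h
  linarith

/-- The map `φ_J` as a continuous real linear map. -/
noncomputable def phiL (J : A) : ℂ →L[ℝ] A :=
  Complex.reCLM.smulRight (1 : A) + Complex.imCLM.smulRight J

@[simp] theorem phiL_apply (J : A) (z : ℂ) : phiL J z = phi J z := rfl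

theorem phi_add (J : A) (z w : ℂ) : phi J (z + w) = phi J z + phi J w := (phiL J).map_add z w

theorem phi_sub (J : A) (z w : ℂ) : phi J (z - w) = phi J z - phi J w := (phiL J).map_sub z w

@[simp] theorem phi_ofReal (J : A) (r : ℝ) : phi J r = r • (1 : A) := by simp [phi]

theorem phi_one (J : A) : phi J 1 = 1 := by simp [phi]

theorem phi_neg_star (J : A) (z : ℂ) : phi (-J) (star z) = phi J z := by simp [phi]

/-- Left alternativity gives `J(Ja) = -a`, so left multiplication through `φ_J` makes `A` a complex
vector space even when `A` is not associative. -/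
theorem phi_mul_mul {J : A} (hJ : J ∈ imUnits A) (z w : ℂ) (a : A) :
    phi J z * (phi J w * a) = phi J (z * w) * a := by
  simp only [phi, add_mul, mul_add, smul_mul_assoc, mul_smul_comm, one_mul, imUnit_mul_mul hJ,
    Complex.mul_re, Complex.mul_im, sub_smul, add_smul, sub_mul, smul_neg, smul_smul, smul_add]
  rw [mul_comm w.re z.im, mul_comm w.im z.im, mul_comm w.re z.re, mul_comm w.im z.re]
  abel

theorem phi_mul {J : A} (hJ : J ∈ imUnits A) (z w : ℂ) : phi J (z * w) = phi J z * phi J w := by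
  simpa using (phi_mul_mul hJ z w 1).symm

theorem star_phi {J : A} (hJ : J ∈ imUnits A) (z : ℂ) : star (phi J z) = phi J (star z) := by
  simp [phi, star_imUnit hJ]

theorem norm_phi {J : A} (hJ : J ∈ imUnits A) (z : ℂ) : ‖phi J z‖ = ‖z‖ := by
  have h := IsHypercomplex.mul_star (phi J z)
  rw [star_phi hJ, ← phi_mul hJ, Complex.star_def, Complex.mul_conj, phi_ofReal,
    IsHypercomplex.smul_one_inj, Complex.normSq_eq_norm_sq] at h
  exact ((sq_eq_sq₀ (norm_nonneg _) (norm_nonneg _)).1 h).symm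

theorem re_phi {J : A} (hJ : J ∈ imUnits A) (z : ℂ) : re (phi J z) = z.re := by
  simp [phi, re_imUnit hJ]

theorem imPart_phi {J : A} (hJ : J ∈ imUnits A) (z : ℂ) : imPart (phi J z) = z.im • J := by
  rw [imPart, star_phi hJ, ← phi_sub]
  simp only [phi, Complex.sub_re, Complex.sub_im, Complex.star_def, Complex.conj_re,
    Complex.conj_im, sub_self, zero_smul, zero_add, smul_smul]
  congr 1; ring

theorem norm_imPart_phi {J : A} (hJ : J ∈ imUnits A) (z : ℂ) : ‖imPart (phi J z)‖ = |z.im| := by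
  rw [imPart_phi hJ, norm_smul, norm_imUnit hJ, mul_one, Real.norm_eq_abs]

theorem phi_injective {J : A} (hJ : J ∈ imUnits A) : Function.Injective (phi J) := by
  intro z w h
  rw [← sub_eq_zero, ← phi_sub, ← norm_eq_zero, norm_phi hJ, norm_eq_zero, sub_eq_zero] at h
  exact h

/-- The coordinates of a point with respect to different slices. -/
theorem phi_eq_phi {J K : A} (hJ : J ∈ imUnits A) (hK : K ∈ imUnits A) {z w : ℂ}
    (h : phi J z = phi K w) :
    (w = z ∧ (z.im = 0 ∨ K = J)) ∨ (w = star z ∧ K = -J) := by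
  have hre : z.re = w.re := by rw [← re_phi hJ, h, re_phi hK]
  have him : z.im • J = w.im • K := by rw [← imPart_phi hJ, h, imPart_phi hK]
  have habs : |z.im| = |w.im| := by rw [← norm_imPart_phi hJ, h, norm_imPart_phi hK]
  rcases eq_or_ne z.im 0 with h0 | h0
  · left
    refine ⟨Complex.ext hre.symm ?_, Or.inl h0⟩
    rw [h0, abs_zero, eq_comm, abs_eq_zero] at habs
    rw [habs, h0]
  rcases abs_eq_abs.1 habs with h1 | h1
  · left
    refine ⟨Complex.ext hre.symm h1.symm, Or.inr ?_⟩
    rw [← h1] at him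
    exact (smul_right_injective A h0 him).symm
  · right
    refine ⟨Complex.ext (by simp [hre]) (by simp [h1]), ?_⟩
    rw [h1, neg_smul, ← smul_neg] at him
    rw [h1] at h0
    exact (smul_right_injective A (neg_ne_zero.1 h0) him).symm

/-- The point `α + iβ` of the closed upper half plane such that `x` belongs to `α + β𝕊`. -/
noncomputable def toC (x : A) : ℂ := ⟨re x, ‖imPart x‖⟩

variable (A) in
theorem continuous_toC : Continuous (toC : A → ℂ) := by
  have h : (toC : A → ℂ) = fun x => (re x : ℂ) + (‖imPart x‖ : ℂ) * Complex.I := by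
    funext x; apply Complex.ext <;> simp [toC]
  rw [h]
  have h1 := IsHypercomplex.continuous_re A
  have h2 := IsHypercomplex.continuous_star (A := A)
  unfold imPart
  fun_prop

theorem exists_phi_eq (x : A) : ∃ J ∈ imUnits A, x = phi J (toC x) := by
  have h0 : x = re x • (1 : A) + imPart x := by
    rw [← IsHypercomplex.rePart_eq, rePart, imPart, ← smul_add]
    rw [show x + star x + (x - star x) = (2 : ℝ) • x by rw [two_smul]; abel, smul_smul]
    norm_num
  rcases eq_or_ne (imPart x) 0 with h | h
  · obtain ⟨J, hJ⟩ := IsHypercomplex.exists_imUnit (A := A)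
    refine ⟨J, hJ, ?_⟩
    nth_rw 1 [h0]
    simp [phi, toC, h]
  · have hn : ‖imPart x‖ ≠ 0 := norm_ne_zero_iff.2 h
    have hs : star (imPart x) = -imPart x := by
      rw [imPart, star_smul, star_sub, star_star, ← smul_neg, neg_sub]; simp
    refine ⟨‖imPart x‖⁻¹ • imPart x, ⟨?_, ?_⟩, ?_⟩
    · rw [star_smul, hs]; simp
    · rw [IsHypercomplex.mul_star, norm_smul, norm_inv, norm_norm, inv_mul_cancel₀ hn]
      simp
    · nth_rw 1 [h0]
      simp [phi, toC, smul_smul, hn]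

end Slices

/-! ### Circular sets and their profiles. -/

section Circular

theorem profile_star {U : Set A} {z : ℂ} (h : z ∈ profile U) : star z ∈ profile U := by
  obtain ⟨J, hJ, hz⟩ := h
  exact ⟨-J, neg_mem_imUnits hJ, by rwa [phi_neg_star]⟩

/-- Two descriptions of one point have equal or conjugate coordinates; in the conjugate case the
sign of `J` is changed. Thus membership in `U` can be tested on any single slice. -/
theorem IsCircular.phi_mem {U : Set A} (h : IsCircular U) {J : A} (hJ : J ∈ imUnits A) {z : ℂ} :
    phi J z ∈ U ↔ z ∈ profile U := by
  refine ⟨fun hz => ⟨J, hJ, hz⟩, ?_⟩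
  rintro ⟨K, hK, hz⟩
  obtain ⟨E, rfl⟩ := h
  obtain ⟨w, hw, L, hL, he⟩ := hz
  rcases phi_eq_phi hK hL he with ⟨rfl, -⟩ | ⟨rfl, -⟩
  · exact ⟨_, hw, J, hJ, rfl⟩
  · exact ⟨_, hw, -J, neg_mem_imUnits hJ, (phi_neg_star J z).symm⟩

theorem IsCircular.mem_iff {U : Set A} (h : IsCircular U) {x : A} : x ∈ U ↔ toC x ∈ profile U := by
  obtain ⟨J, hJ, hx⟩ := exists_phi_eq x
  rw [← h.phi_mem hJ, ← hx]

theorem profile_circularization {D : Set ℂ} (hD : ∀ z ∈ D, star z ∈ D) :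
    profile (circularization A D) = D := by
  ext z
  constructor
  · rintro ⟨J, hJ, w, hw, K, hK, h⟩
    rcases phi_eq_phi hJ hK h with ⟨rfl, -⟩ | ⟨rfl, -⟩
    · exact hw
    · simpa using hD _ hw
  · intro hz
    obtain ⟨J, hJ⟩ := IsHypercomplex.exists_imUnit (A := A)
    exact ⟨J, hJ, z, hz, J, hJ, rfl⟩

theorem isCircular_circularization (D : Set ℂ) : IsCircular (circularization A D) := ⟨D, rfl⟩

theorem isOpen_profile {U : Set A} (h : IsCircular U) (ho : IsOpen U) : IsOpen (profile U) := by
  obtain ⟨J, hJ⟩ := IsHypercomplex.exists_imUnit (A := A)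
  have : profile U = phi J ⁻¹' U := by ext z; exact (h.phi_mem hJ).symm
  rw [this]
  exact ho.preimage (continuous_phi J)

theorem isOpen_circularization {D : Set ℂ} (hD : ∀ z ∈ D, star z ∈ D) (ho : IsOpen D) :
    IsOpen (circularization A D) := by
  have : circularization A D = toC ⁻¹' D := by
    ext x
    rw [(isCircular_circularization D).mem_iff, profile_circularization hD]; rfl
  rw [this]
  exact ho.preimage (continuous_toC A)

theorem profile_mono {U V : Set A} (h : U ⊆ V) : profile U ⊆ profile V :=
  fun _ ⟨J, hJ, hz⟩ => ⟨J, hJ, h hz⟩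

theorem IsCircular.profile_inter {U V : Set A} (hV : IsCircular V) :
    profile (U ∩ V) = profile U ∩ profile V := by
  refine Set.Subset.antisymm (fun z hz => ⟨profile_mono Set.inter_subset_left hz,
    profile_mono Set.inter_subset_right hz⟩) ?_
  rintro z ⟨⟨J, hJ, hz⟩, h⟩
  exact ⟨J, hJ, hz, (hV.phi_mem hJ).2 h⟩

theorem IsCircular.inter {U V : Set A} (hU : IsCircular U) (hV : IsCircular V) :
    IsCircular (U ∩ V) := by
  refine ⟨profile U ∩ profile V, ?_⟩
  ext x
  have hD : ∀ z ∈ profile U ∩ profile V, star z ∈ profile U ∩ profile V :=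
    fun z hz => ⟨profile_star hz.1, profile_star hz.2⟩
  rw [(isCircular_circularization _).mem_iff, profile_circularization hD]
  exact and_congr hU.mem_iff hV.mem_iff

end Circular

/-! ### Recovering a stem function from the slice function it induces. -/

section Stems

open Complexification

/-- With `im_eq_of_eval` this is the representation formula: the values at `J` and `-J` determine
both components. -/
theorem re_eq_of_eval (J : A) (w : Complexification A) :
    w.re = (2⁻¹ : ℝ) • (w.eval J + w.eval (-J)) := by
  simp only [eval, neg_mul]
  rw [show w.re + J * w.im + (w.re + -(J * w.im)) = (2 : ℝ) • w.re by rw [two_smul]; abel,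
    smul_smul]
  norm_num

theorem im_eq_of_eval {J : A} (hJ : J ∈ imUnits A) (w : Complexification A) :
    w.im = -(J * ((2⁻¹ : ℝ) • (w.eval J - w.eval (-J)))) := by
  simp only [eval, neg_mul]
  rw [show w.re + J * w.im - (w.re + -(J * w.im)) = (2 : ℝ) • (J * w.im) by rw [two_smul]; abel,
    smul_smul]
  norm_num
  rw [imUnit_mul_mul hJ, neg_neg]

theorem ext_of_eval {J : A} (hJ : J ∈ imUnits A) {v w : Complexification A}
    (h1 : v.eval J = w.eval J) (h2 : v.eval (-J) = w.eval (-J)) : v = w := by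
  ext1
  · rw [re_eq_of_eval J, h1, h2, ← re_eq_of_eval J]
  · rw [im_eq_of_eval hJ, h1, h2, ← im_eq_of_eval hJ]

/-- Applied at real `z`, where the stem condition reads `F(z) = conj F(z)`: there `F₂` vanishes. -/
theorem eq_zero_of_conj_eq {w : Complexification A} (h : w.conj = w) : w.im = 0 := by
  have := congrArg Complexification.im h
  rw [conj_im, neg_eq_iff_add_eq_zero, ← two_smul ℝ] at this
  simpa using this

/-- The values of an induced function at the two points of a slice determine the stem function. -/
theorem IsInducedBy.eval_neg {U : Set A} {F : ℂ → Complexification A} {f : A → A}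
    (h : IsInducedBy U F f) {J : A} (hJ : J ∈ imUnits A) {z : ℂ} (hU : IsCircular U)
    (hz : z ∈ profile U) : f (phi J (star z)) = (F z).eval (-J) := by
  have h1 := h.2 (star z) J hJ ((hU.phi_mem hJ).2 (profile_star hz))
  rw [h1, h.1 z hz, ← eval_conj J, conj_conj]

/-- Uniqueness of the stem: the profile contains `z̄` along with `z`, and the values of the function
at `φ_J(z)` and `φ_J(z̄)` recover `F(z)`. -/
theorem IsInducedBy.eqOn {U V : Set A} {F G : ℂ → Complexification A} {f g : A → A}
    (hf : IsInducedBy U F f) (hg : IsInducedBy V G g) (hU : IsCircular U) (hV : IsCircular V)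
    (h : Set.EqOn f g (U ∩ V)) : Set.EqOn F G (profile U ∩ profile V) := by
  rintro z ⟨hzU, hzV⟩
  obtain ⟨J, hJ⟩ := IsHypercomplex.exists_imUnit (A := A)
  apply ext_of_eval hJ
  · rw [← hf.2 z J hJ ((hU.phi_mem hJ).2 hzU), ← hg.2 z J hJ ((hV.phi_mem hJ).2 hzV)]
    exact h ⟨(hU.phi_mem hJ).2 hzU, (hV.phi_mem hJ).2 hzV⟩
  · rw [← hf.eval_neg hJ hU hzU, ← hg.eval_neg hJ hV hzV]
    exact h ⟨(hU.phi_mem hJ).2 (profile_star hzU), (hV.phi_mem hJ).2 (profile_star hzV)⟩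

theorem IsInducedBy.mono {U V : Set A} {F : ℂ → Complexification A} {f : A → A}
    (h : IsInducedBy U F f) (hV : V ⊆ U) : IsInducedBy V F f :=
  ⟨fun z hz => h.1 z (profile_mono hV hz), fun z J hJ hz => h.2 z J hJ (hV hz)⟩

/-- The slice function induced by a stem function. -/
noncomputable def induced (F : ℂ → Complexification A) (x : A) : A :=
  (F (toC x)).eval (exists_phi_eq x).choose

/-- The unit chosen in `induced` does not matter: off the real axis it is determined up to a sign,
which the stem condition absorbs, and on the real axis `F₂ = 0`. -/
theorem isInducedBy_induced {U : Set A} {F : ℂ → Complexification A}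
    (hF : IsStem (profile U) F) : IsInducedBy U F (induced F) := by
  refine ⟨hF, fun z J hJ hz => ?_⟩
  obtain ⟨hK, hx⟩ := (exists_phi_eq (phi J z)).choose_spec
  unfold induced
  generalize (exists_phi_eq (phi J z)).choose = K at *
  have hz' : z ∈ profile U := ⟨J, hJ, hz⟩
  rcases phi_eq_phi hJ hK hx with ⟨h1, h2 | h2⟩ | ⟨h1, h2⟩
  · rw [h1]
    have h3 : star z = z := Complex.ext (by simp) (by simp [h2])
    have h4 := hF z hz'
    rw [h3] at h4
    simp [eval, eq_zero_of_conj_eq h4.symm]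
  · rw [h1, h2]
  · rw [h1, h2, hF z hz', eval_conj]

end Stems

end SliceRegular

/-! ### Holomorphic stem functions -/

namespace SliceRegular

set_option linter.unusedSectionVars false

variable {A : Type*} [NonAssocNormedRing A] [StarRing A] [NormedSpace ℝ A] [IsHypercomplex A]

open IsHypercomplex (re)
open Complexification

section Holomorphy

/-- The Cauchy-Riemann equations at one point. -/
def HolomorphicStemAt (F : ℂ → Complexification A) (z : ℂ) : Prop :=
  ∃ L₁ L₂ : ℂ →L[ℝ] A,
    HasFDerivAt (fun w => (F w).re) L₁ z ∧ HasFDerivAt (fun w => (F w).im) L₂ z ∧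
      L₁ 1 = L₂ Complex.I ∧ L₁ Complex.I = -L₂ 1

variable (A) in
/-- The product of `A` as a continuous bilinear map. -/
noncomputable def mulL : A →L[ℝ] A →L[ℝ] A :=
  LinearMap.mkContinuous₂ (LinearMap.mk₂ ℝ (fun x y : A => x * y) add_mul smul_mul_assoc mul_add
    fun c x y => mul_smul_comm c x y) 1 fun x y => by
      simpa using NonAssocNormedRing.norm_mul_le x y

@[simp] theorem mulL_apply (x y : A) : mulL A x y = x * y := rfl

/-- The involution of `A` as a continuous linear map. -/
noncomputable def starL : A →L[ℝ] A where
  toFun := star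
  map_add' := star_add
  map_smul' r x := by simp
  cont := IsHypercomplex.continuous_star

@[simp] theorem starL_apply (x : A) : (starL : A →L[ℝ] A) x = star x := rfl

variable {F G : ℂ → Complexification A} {z : ℂ}

theorem HolomorphicStemAt.continuousAt_re (h : HolomorphicStemAt F z) :
    ContinuousAt (fun w => (F w).re) z := by
  obtain ⟨_, _, h1, -⟩ := h
  exact h1.continuousAt

theorem HolomorphicStemAt.continuousAt_im (h : HolomorphicStemAt F z) :
    ContinuousAt (fun w => (F w).im) z := by
  obtain ⟨_, _, -, h1, -⟩ := h
  exact h1.continuousAt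

theorem HolomorphicStemAt.congr (h : HolomorphicStemAt F z) (hFG : F =ᶠ[𝓝 z] G) :
    HolomorphicStemAt G z := by
  obtain ⟨L₁, L₂, h1, h2, h3⟩ := h
  exact ⟨L₁, L₂, h1.congr_of_eventuallyEq (hFG.mono fun w hw => by simp [hw]),
    h2.congr_of_eventuallyEq (hFG.mono fun w hw => by simp [hw]), h3⟩

theorem holomorphicStemAt_const (w : Complexification A) : HolomorphicStemAt (fun _ => w) z :=
  ⟨0, 0, hasFDerivAt_const _ _, hasFDerivAt_const _ _, by simp, by simp⟩

theorem HolomorphicStemAt.add (hF : HolomorphicStemAt F z) (hG : HolomorphicStemAt G z) :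
    HolomorphicStemAt (fun w => F w + G w) z := by
  obtain ⟨L₁, L₂, h1, h2, h3, h4⟩ := hF
  obtain ⟨M₁, M₂, k1, k2, k3, k4⟩ := hG
  refine ⟨L₁ + M₁, L₂ + M₂, h1.add k1, h2.add k2, ?_, ?_⟩
  · simp [h3, k3]
  · simp [h4, k4, add_comm]

theorem HolomorphicStemAt.star (hF : HolomorphicStemAt F z) :
    HolomorphicStemAt (fun w => star (F w)) z := by
  obtain ⟨L₁, L₂, h1, h2, h3, h4⟩ := hF
  refine ⟨starL.comp L₁, starL.comp L₂, starL.hasFDerivAt.comp z h1, starL.hasFDerivAt.comp z h2,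
    ?_, ?_⟩
  · simp [h3]
  · simp [h4]

/-- The Leibniz rule for a bilinear product needs neither associativity nor commutativity, and the
Cauchy-Riemann equations of the factors combine term by term. -/
theorem HolomorphicStemAt.mul (hF : HolomorphicStemAt F z) (hG : HolomorphicStemAt G z) :
    HolomorphicStemAt (fun w => F w * G w) z := by
  obtain ⟨L₁, L₂, h1, h2, h3, h4⟩ := hF
  obtain ⟨M₁, M₂, k1, k2, k3, k4⟩ := hG
  refine ⟨_, _, ((mulL A).hasFDerivAt_of_bilinear h1 k1).sub
    ((mulL A).hasFDerivAt_of_bilinear h2 k2),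
    ((mulL A).hasFDerivAt_of_bilinear h1 k2).add
    ((mulL A).hasFDerivAt_of_bilinear h2 k1), ?_, ?_⟩
  · simp [h3, h4, k3, k4]; abel
  · simp [h3, h4, k3, k4]; abel

/-- A complex function as a scalar stem function. -/
theorem HolomorphicStemAt.of_differentiableAt {g : ℂ → ℂ} (hg : DifferentiableAt ℂ g z) :
    HolomorphicStemAt (fun w => g w • (1 : Complexification A)) z := by
  have h := hg.hasDerivAt.hasFDerivAt.restrictScalars ℝ
  refine ⟨_, _, ((Complex.reCLM.hasFDerivAt.comp z h).smul_const (1 : A)).congr_of_eventuallyEq ?_,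
    ((Complex.imCLM.hasFDerivAt.comp z h).smul_const (1 : A)).congr_of_eventuallyEq ?_, ?_, ?_⟩
  · exact Filter.Eventually.of_forall fun w => by simp
  · exact Filter.Eventually.of_forall fun w => by simp
  · simp
  · simp

theorem HolomorphicStemAt.csmul {g : ℂ → ℂ} (hg : DifferentiableAt ℂ g z)
    (hF : HolomorphicStemAt F z) : HolomorphicStemAt (fun w => g w • F w) z := by
  have := (HolomorphicStemAt.of_differentiableAt (A := A) hg).mul hF
  simpa only [csmul_mul, one_mul] using this

/-- The complexification of a linear functional. -/
noncomputable def coordC (l : A →ₗ[ℝ] ℝ) (w : Complexification A) : ℂ := ⟨l w.re, l w.im⟩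

theorem coordC_conj (l : A →ₗ[ℝ] ℝ) (w : Complexification A) :
    coordC l w.conj = Star.star (coordC l w) := by
  apply Complex.ext <;> simp [coordC]

/-- Exhibits `n(F)` as a coordinate of `F Fᶜ`, so its regularity follows from that of products and
coordinates. -/
theorem normC_eq_coordC (w : Complexification A) : normC w = coordC re (w * Star.star w) := by
  rw [mul_star_self]
  apply Complex.ext <;> simp [coordC]

/-- A real functional carries the Cauchy-Riemann equations of `F` to those of a scalar function;
this is the passage to one-variable complex analysis. -/
theorem HolomorphicStemAt.differentiableAt_coordC (l : A →ₗ[ℝ] ℝ) (hF : HolomorphicStemAt F z) :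
    DifferentiableAt ℂ (fun w => coordC l (F w)) z := by
  have := IsHypercomplex.finiteDimensional (A := A)
  obtain ⟨L₁, L₂, h1, h2, h3, h4⟩ := hF
  let l' : A →L[ℝ] ℝ := l.toContinuousLinearMap
  have k1 := Complex.ofRealCLM.hasFDerivAt.comp z (l'.hasFDerivAt.comp z h1)
  have k2 := Complex.ofRealCLM.hasFDerivAt.comp z (l'.hasFDerivAt.comp z h2)
  have k := k1.add (k2.mul_const Complex.I)
  have he : (fun w => coordC l (F w)) = fun w => ((l (F w).re : ℝ) : ℂ) +
      ((l (F w).im : ℝ) : ℂ) * Complex.I := by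
    funext w; apply Complex.ext <;> simp [coordC]
  rw [he, differentiableAt_complex_iff_differentiableAt_real]
  have hk : HasFDerivAt (fun w => ((l (F w).re : ℝ) : ℂ) +
      ((l (F w).im : ℝ) : ℂ) * Complex.I) _ z := k
  refine ⟨hk.differentiableAt, ?_⟩
  rw [hk.fderiv]
  apply Complex.ext <;> simp [l', h3, h4]

theorem HolomorphicStemAt.differentiableAt_normC (hF : HolomorphicStemAt F z) :
    DifferentiableAt ℂ (fun w => normC (F w)) z := by
  simp only [normC_eq_coordC]
  exact (hF.mul hF.star).differentiableAt_coordC re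

end Holomorphy

/-! ### Functions of polynomial growth at a puncture -/

section Growth

open Filter

/-- `F` is holomorphic near `z`, except possibly at `z`, where it grows at most like a power of
`(w - z)⁻¹`. -/
def MeromorphicStemAt (F : ℂ → Complexification A) (z : ℂ) : Prop :=
  (∀ᶠ w in 𝓝[≠] z, HolomorphicStemAt F w) ∧
    ∃ (m : ℕ) (C : ℝ), ∀ᶠ w in 𝓝[≠] z, ‖w - z‖ ^ m * ‖(F w).re‖ ≤ C ∧ ‖w - z‖ ^ m * ‖(F w).im‖ ≤ C

/-- The exponent in a growth bound may be increased. -/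
theorem growth_mono {α : Type*} [NormedAddCommGroup α] {f : ℂ → α} {z : ℂ} {m n : ℕ} {C : ℝ}
    (hmn : m ≤ n) (h : ∀ᶠ w in 𝓝[≠] z, ‖w - z‖ ^ m * ‖f w‖ ≤ C) :
    ∀ᶠ w in 𝓝[≠] z, ‖w - z‖ ^ n * ‖f w‖ ≤ C := by
  have h1 : ∀ᶠ w in 𝓝[≠] z, ‖w - z‖ ≤ 1 := by
    refine nhdsWithin_le_nhds ?_
    filter_upwards [Metric.ball_mem_nhds z one_pos] with w hw
    rw [← dist_eq_norm]; exact (Metric.mem_ball.1 hw).le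
  filter_upwards [h, h1] with w hw hw1
  exact (mul_le_mul_of_nonneg_right (pow_le_pow_of_le_one (norm_nonneg _) hw1 hmn)
    (norm_nonneg _)).trans hw

variable {F G : ℂ → Complexification A} {z : ℂ}

theorem MeromorphicStemAt.of_eventually (hF : ∀ᶠ w in 𝓝[≠] z, HolomorphicStemAt F w) {m n : ℕ}
    {C D : ℝ} (h1 : ∀ᶠ w in 𝓝[≠] z, ‖w - z‖ ^ m * ‖(F w).re‖ ≤ C)
    (h2 : ∀ᶠ w in 𝓝[≠] z, ‖w - z‖ ^ n * ‖(F w).im‖ ≤ D) : MeromorphicStemAt F z := by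
  refine ⟨hF, max m n, max C D, ?_⟩
  filter_upwards [growth_mono (le_max_left m n) h1, growth_mono (le_max_right m n) h2] with w k1 k2
  exact ⟨k1.trans (le_max_left _ _), k2.trans (le_max_right _ _)⟩

theorem HolomorphicStemAt.meromorphicStemAt (hF : ∀ᶠ w in 𝓝 z, HolomorphicStemAt F w) :
    MeromorphicStemAt F z := by
  have h := hF.self_of_nhds
  refine .of_eventually (m := 0) (n := 0) (C := ‖(F z).re‖ + 1) (D := ‖(F z).im‖ + 1)
    (hF.filter_mono nhdsWithin_le_nhds) ?_ ?_
  · filter_upwards [nhdsWithin_le_nhds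
      (h.continuousAt_re.norm.eventually_lt continuousAt_const (lt_add_one _))] with w hw
    simpa using hw.le
  · filter_upwards [nhdsWithin_le_nhds
      (h.continuousAt_im.norm.eventually_lt continuousAt_const (lt_add_one _))] with w hw
    simpa using hw.le

theorem MeromorphicStemAt.star (hF : MeromorphicStemAt F z) :
    MeromorphicStemAt (fun w => star (F w)) z := by
  obtain ⟨h1, m, C, h2⟩ := hF
  refine ⟨h1.mono fun w hw => hw.star, m, C, ?_⟩
  simpa [IsHypercomplex.norm_star] using h2

theorem MeromorphicStemAt.add (hF : MeromorphicStemAt F z) (hG : MeromorphicStemAt G z) :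
    MeromorphicStemAt (fun w => F w + G w) z := by
  obtain ⟨h1, m, C, h2⟩ := hF
  obtain ⟨k1, n, D, k2⟩ := hG
  refine .of_eventually (m := m + n) (n := m + n) (C := C + D) (D := C + D)
    (by filter_upwards [h1, k1] with w hw kw using hw.add kw) ?_ ?_
  · filter_upwards [growth_mono (Nat.le_add_right m n) (h2.mono fun w hw => hw.1),
      growth_mono (Nat.le_add_left n m) (k2.mono fun w hw => hw.1)] with w a b
    refine (mul_le_mul_of_nonneg_left (norm_add_le _ _) (by positivity)).trans ?_
    rw [mul_add]; exact add_le_add a b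
  · filter_upwards [growth_mono (Nat.le_add_right m n) (h2.mono fun w hw => hw.2),
      growth_mono (Nat.le_add_left n m) (k2.mono fun w hw => hw.2)] with w a b
    refine (mul_le_mul_of_nonneg_left (norm_add_le _ _) (by positivity)).trans ?_
    rw [mul_add]; exact add_le_add a b

theorem MeromorphicStemAt.mul (hF : MeromorphicStemAt F z) (hG : MeromorphicStemAt G z) :
    MeromorphicStemAt (fun w => F w * G w) z := by
  obtain ⟨h1, m, C, h2⟩ := hF
  obtain ⟨k1, n, D, k2⟩ := hG
  have key : ∀ (a b : A) (r : ℝ), 0 ≤ r → r ^ m * ‖a‖ ≤ C → r ^ n * ‖b‖ ≤ D →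
      r ^ (m + n) * ‖a * b‖ ≤ C * D := by
    intro a b r hr ha hb
    calc r ^ (m + n) * ‖a * b‖ ≤ r ^ (m + n) * (‖a‖ * ‖b‖) :=
          mul_le_mul_of_nonneg_left (NonAssocNormedRing.norm_mul_le a b) (by positivity)
      _ = (r ^ m * ‖a‖) * (r ^ n * ‖b‖) := by ring
      _ ≤ C * D := mul_le_mul ha hb (by positivity) (le_trans (by positivity) ha)
  refine .of_eventually (m := m + n) (n := m + n) (C := C * D + C * D) (D := C * D + C * D)
    (by filter_upwards [h1, k1] with w hw kw using hw.mul kw) ?_ ?_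
  · filter_upwards [h2, k2] with w a b
    refine (mul_le_mul_of_nonneg_left (norm_sub_le _ _) (by positivity)).trans ?_
    rw [mul_add]
    exact add_le_add (key _ _ _ (norm_nonneg _) a.1 b.1) (key _ _ _ (norm_nonneg _) a.2 b.2)
  · filter_upwards [h2, k2] with w a b
    refine (mul_le_mul_of_nonneg_left (norm_add_le _ _) (by positivity)).trans ?_
    rw [mul_add]
    exact add_le_add (key _ _ _ (norm_nonneg _) a.1 b.2) (key _ _ _ (norm_nonneg _) a.2 b.1)

theorem meromorphicStemAt_const (w : Complexification A) : MeromorphicStemAt (fun _ => w) z :=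
  HolomorphicStemAt.meromorphicStemAt (.of_forall fun _ => holomorphicStemAt_const w)

/-- A scalar function of polynomial growth is meromorphic. -/
theorem meromorphicAt_of_growth {g : ℂ → ℂ} (hg : ∀ᶠ w in 𝓝[≠] z, DifferentiableAt ℂ g w) {m : ℕ}
    {C : ℝ} (h : ∀ᶠ w in 𝓝[≠] z, ‖w - z‖ ^ m * ‖g w‖ ≤ C) : MeromorphicAt g z := by
  -- The exponent `m + 1` in place of `m` makes the product tend to `0`, which is its value at `z`;
  -- Riemann's removable singularity theorem then applies.
  refine ⟨m + 1, Complex.analyticAt_of_differentiable_on_punctured_nhds_of_continuousAt ?_ ?_⟩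
  · filter_upwards [hg] with w hw
    fun_prop
  · rw [continuousAt_iff_punctured_nhds]
    simp only [sub_self, ne_eq, Nat.add_eq_zero_iff, one_ne_zero, and_false, not_false_eq_true,
      zero_pow, zero_smul]
    have h0 : Tendsto (fun w : ℂ => ‖w - z‖ * C) (𝓝[≠] z) (𝓝 0) := by
      have : Continuous fun w : ℂ => ‖w - z‖ * C := by fun_prop
      have := this.tendsto z
      simp only [sub_self, norm_zero, zero_mul] at this
      exact this.mono_left nhdsWithin_le_nhds
    refine squeeze_zero_norm' ?_ h0
    filter_upwards [h] with w hw
    rw [norm_smul, norm_pow, pow_succ', mul_assoc]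
    exact mul_le_mul_of_nonneg_left hw (norm_nonneg _)

theorem growth_of_meromorphicAt {g : ℂ → ℂ} (h : MeromorphicAt g z) :
    ∃ (m : ℕ) (C : ℝ), ∀ᶠ w in 𝓝[≠] z, ‖w - z‖ ^ m * ‖g w‖ ≤ C := by
  obtain ⟨m, hm⟩ := h
  -- The value at `z` of the analytic function `(w - z) ^ m • g w`, plus `1`, bounds it nearby by
  -- continuity.
  refine ⟨m, ‖(z - z) ^ m • g z‖ + 1, ?_⟩
  filter_upwards [nhdsWithin_le_nhds
    (hm.continuousAt.norm.eventually_lt continuousAt_const (lt_add_one _))] with w hw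
  rw [norm_smul, norm_pow] at hw
  exact hw.le

theorem MeromorphicStemAt.meromorphicAt_coordC (l : A →ₗ[ℝ] ℝ) (hF : MeromorphicStemAt F z) :
    MeromorphicAt (fun w => coordC l (F w)) z := by
  have := IsHypercomplex.finiteDimensional (A := A)
  obtain ⟨h1, m, C, h2⟩ := hF
  let l' : A →L[ℝ] ℝ := l.toContinuousLinearMap
  refine meromorphicAt_of_growth (m := m) (C := ‖l'‖ * C + ‖l'‖ * C)
    (h1.mono fun w hw => hw.differentiableAt_coordC l) ?_
  filter_upwards [h2] with w hw
  have hb : ‖coordC l (F w)‖ ≤ ‖l'‖ * ‖(F w).re‖ + ‖l'‖ * ‖(F w).im‖ :=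
    (Complex.norm_le_abs_re_add_abs_im _).trans (add_le_add (l'.le_opNorm _) (l'.le_opNorm _))
  calc ‖w - z‖ ^ m * ‖coordC l (F w)‖
      ≤ ‖w - z‖ ^ m * (‖l'‖ * ‖(F w).re‖ + ‖l'‖ * ‖(F w).im‖) :=
        mul_le_mul_of_nonneg_left hb (by positivity)
    _ = ‖l'‖ * (‖w - z‖ ^ m * ‖(F w).re‖) + ‖l'‖ * (‖w - z‖ ^ m * ‖(F w).im‖) := by ring
    _ ≤ _ := add_le_add (mul_le_mul_of_nonneg_left hw.1 (norm_nonneg _))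
        (mul_le_mul_of_nonneg_left hw.2 (norm_nonneg _))

theorem MeromorphicStemAt.meromorphicAt_normC (hF : MeromorphicStemAt F z) :
    MeromorphicAt (fun w => normC (F w)) z := by
  simp only [normC_eq_coordC]
  exact (hF.mul hF.star).meromorphicAt_coordC re

theorem MeromorphicStemAt.of_meromorphicAt {g : ℂ → ℂ} (hg : MeromorphicAt g z) :
    MeromorphicStemAt (fun w => g w • (1 : Complexification A)) z := by
  obtain ⟨m, C, h⟩ := growth_of_meromorphicAt hg
  refine .of_eventually (m := m) (n := m) (C := C) (D := C) ?_ ?_ ?_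
  · filter_upwards [hg.eventually_analyticAt] with w hw
    exact .of_differentiableAt hw.differentiableAt
  · filter_upwards [h] with w hw
    refine le_trans (mul_le_mul_of_nonneg_left ?_ (by positivity)) hw
    simpa [norm_smul, IsHypercomplex.norm_one] using Complex.abs_re_le_norm (g w)
  · filter_upwards [h] with w hw
    refine le_trans (mul_le_mul_of_nonneg_left ?_ (by positivity)) hw
    simpa [norm_smul, IsHypercomplex.norm_one] using Complex.abs_im_le_norm (g w)

theorem MeromorphicStemAt.csmul {g : ℂ → ℂ} (hg : MeromorphicAt g z)
    (hF : MeromorphicStemAt F z) : MeromorphicStemAt (fun w => g w • F w) z := by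
  have := (MeromorphicStemAt.of_meromorphicAt (A := A) hg).mul hF
  simpa only [csmul_mul, one_mul] using this

end Growth

end SliceRegular

/-! ### Singularities -/

namespace SliceRegular

set_option linter.unusedSectionVars false

variable {A : Type*} [NonAssocNormedRing A] [StarRing A] [NormedSpace ℝ A] [IsHypercomplex A]

open Complexification Filter

/-! ### Slice powers of `x - y` restricted to the slice through `y`. -/

section Binomial

/-- `w` is an element of `ℂ_J ⊗ ℂ` with image `c` in `ℂ_J`. -/
def InSlice (J : A) (w : Complexification A) (c : ℂ) : Prop :=
  ∃ u v : ℂ, w = ⟨phi J u, phi J v⟩ ∧ u + Complex.I * v = c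

variable {J : A} {v w : Complexification A} {c d : ℂ}

theorem phi_I (J : A) : phi J Complex.I = J := by simp [phi]

/-- On `ℂ_J ⊗ ℂ`, evaluation at `J` is multiplicative, which fails on `A ⊗ ℂ` in general. It turns
slice power series centred in `ℂ_J` into ordinary ones on that slice. -/
theorem InSlice.eval_mul_const (hJ : J ∈ imUnits A) (h : InSlice J w c) (a : A) :
    (w * const a).eval J = phi J c * a := by
  obtain ⟨u, v, rfl, rfl⟩ := h
  have hJv : J * (phi J v * a) = phi J (Complex.I * v) * a := by
    rw [← phi_mul_mul hJ, phi_I]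
  simp [eval, hJv, phi_add, add_mul]

theorem InSlice.eval_eq (hJ : J ∈ imUnits A) (h : InSlice J w c) : w.eval J = phi J c := by
  simpa [const_one] using h.eval_mul_const hJ 1

theorem InSlice.unique (hJ : J ∈ imUnits A) (h : InSlice J w c) (h' : InSlice J w d) : c = d :=
  phi_injective hJ ((h.eval_eq hJ).symm.trans (h'.eval_eq hJ))

theorem InSlice.mul (hJ : J ∈ imUnits A) (hv : InSlice J v c) (hw : InSlice J w d) :
    InSlice J (v * w) (c * d) := by
  obtain ⟨u, v, rfl, rfl⟩ := hv
  obtain ⟨u', v', rfl, rfl⟩ := hw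
  refine ⟨u * u' - v * v', u * v' + v * u', ?_, ?_⟩
  · ext1 <;> simp [phi_sub, phi_add, phi_mul hJ]
  · linear_combination (-v * v') * Complex.I_mul_I

theorem inSlice_csmul_one (J : A) (c : ℂ) : InSlice J (c • 1) c :=
  ⟨c.re, c.im, by ext1 <;> simp, by rw [mul_comm]; exact Complex.re_add_im c⟩

theorem InSlice.csmul (hJ : J ∈ imUnits A) (h : InSlice J w d) : InSlice J (c • w) (c * d) := by
  have := (inSlice_csmul_one J c).mul hJ h
  rwa [csmul_mul, one_mul] at this

theorem inSlice_binomialStem (J : A) (z₀ z : ℂ) :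
    InSlice J (binomialStem (phi J z₀) z) (z - z₀) :=
  ⟨z.re - z₀, z.im, by ext1 <;> simp [binomialStem, phi_sub], by
    apply Complex.ext <;> simp; ring⟩

theorem inSlice_star_binomialStem (hJ : J ∈ imUnits A) (z₀ z : ℂ) :
    InSlice J (star (binomialStem (phi J z₀) z)) (z - star z₀) :=
  ⟨z.re - star z₀, z.im, by ext1 <;> simp [binomialStem, phi_sub, star_phi hJ], by
    apply Complex.ext <;> simp; ring⟩

/-- The binomial and its conjugate have images `z - z₀` and `z - z̄₀` in `ℂ_J`, so negative powers
are meaningful exactly off `z₀` and `z̄₀`. -/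
theorem normC_binomialStem (hJ : J ∈ imUnits A) (z₀ z : ℂ) :
    normC (binomialStem (phi J z₀) z) = (z - z₀) * (z - star z₀) := by
  have h := (inSlice_binomialStem J z₀ z).mul hJ (inSlice_star_binomialStem hJ z₀ z)
  rw [mul_star_self] at h
  exact (inSlice_csmul_one J _).unique hJ h

theorem InSlice.npow (hJ : J ∈ imUnits A) (h : InSlice J w c) (n : ℕ) :
    InSlice J (w.npow n) (c ^ n) := by
  induction n with
  | zero =>
    rw [pow_zero]
    simpa [Complexification.npow, const_one] using inSlice_csmul_one J 1
  | succ n ih =>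
    rw [pow_succ']
    exact h.mul hJ ih

/-- For negative exponents, `n⁻¹ (z - z̄₀) = (z - z₀)⁻¹`. The second hypothesis keeps the cancelled
factor nonzero. -/
theorem inSlice_zpow_binomialStem (hJ : J ∈ imUnits A) {z₀ z : ℂ} (h : z ≠ z₀)
    (h' : z ≠ star z₀) (n : ℤ) :
    InSlice J ((binomialStem (phi J z₀) z).zpow n) ((z - z₀) ^ n) := by
  cases n with
  | ofNat n =>
    rw [Int.ofNat_eq_natCast, zpow_natCast]
    exact (inSlice_binomialStem J z₀ z).npow hJ n
  | negSucc n =>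
    rw [zpow_negSucc, ← inv_pow]
    refine InSlice.npow hJ ?_ (n + 1)
    rw [inv_eq]
    have := (inSlice_star_binomialStem hJ z₀ z).csmul (c := (normC (binomialStem (phi J z₀) z))⁻¹) hJ
    convert this using 1
    rw [normC_binomialStem hJ]
    have h1 := sub_ne_zero.2 h
    have h2 := sub_ne_zero.2 h'
    field_simp

theorem conj_npow (w : Complexification A) (n : ℕ) : (w.npow n).conj = w.conj.npow n := by
  induction n with
  | zero => ext1 <;> simp [npow]
  | succ n ih => simp only [npow, Complexification.conj_mul, ih]

theorem conj_inv (w : Complexification A) : w.inv.conj = w.conj.inv := by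
  rw [inv_eq, inv_eq, normC_conj, ← conj_star, Complex.star_def, ← map_inv₀]
  ext1
  · simp only [conj_re, csmul_re, Complex.conj_re, Complex.conj_im, conj_im, neg_smul, smul_neg,
      neg_neg]
  · simp only [conj_re, conj_im, csmul_im, Complex.conj_re, Complex.conj_im, neg_smul, smul_neg,
      neg_add]

/-- Together with `binomialStem_star`, makes every integer power of the binomial a stem function, so
its value is independent of the description of the point. -/
theorem conj_zpow (w : Complexification A) (n : ℤ) : (w.zpow n).conj = w.conj.zpow n := by
  cases n with
  | ofNat n => exact conj_npow w n
  | negSucc n =>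
    simp only [zpow]
    rw [conj_npow, conj_inv]

theorem binomialStem_star (y : A) (z : ℂ) : binomialStem y (star z) = (binomialStem y z).conj := by
  ext1 <;> simp [binomialStem]

/-- The value of a stem function at a point depends only on the point of `A` it stands for. -/
theorem eval_eq_of_phi_eq {K : A} (hJ : J ∈ imUnits A) (hK : K ∈ imUnits A)
    {F : ℂ → Complexification A} {z w : ℂ} (hF : F (star z) = (F z).conj)
    (h : phi J z = phi K w) : (F z).eval J = (F w).eval K := by
  rcases phi_eq_phi hJ hK h with ⟨h1, h2 | h2⟩ | ⟨h1, h2⟩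
  · rw [h1]
    have h3 : star z = z := Complex.ext (by simp) (by simp [h2])
    rw [h3] at hF
    simp [eval, eq_zero_of_conj_eq hF.symm]
  · rw [h1, h2]
  · rw [h1, h2, hF, eval_conj]

end Binomial

/-! ### Shells and their intersection with slices. -/

section Shell

theorem phi_mem_shell {J : A} (hJ : J ∈ imUnits A) {z₀ z : ℂ} {R : ℝ} :
    phi J z ∈ shell (phi J z₀) 0 R ↔ z ≠ z₀ ∧ ‖z - z₀‖ < R := by
  have hs : SameSlice (phi J z) (phi J z₀) := ⟨J, hJ, ⟨_, rfl⟩, ⟨_, rfl⟩⟩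
  simp only [shell, Set.mem_ofPred_eq, tau, sigma, if_pos hs, ← phi_sub, norm_phi hJ, norm_pos_iff,
    sub_ne_zero]

/-- A small shell is contained in the union of the slices through its centre. -/
theorem exists_slice_of_mem_shell {I : A} (hI : I ∈ imUnits A) {z₀ : ℂ} {R : ℝ}
    (hR : z₀.im = 0 ∨ R ≤ |z₀.im|) {x : A} (hx : x ∈ shell (phi I z₀) 0 R) :
    ∃ J ∈ imUnits A, (z₀.im = 0 ∨ J = I) ∧ ∃ z : ℂ, x = phi J z ∧ z ≠ z₀ ∧ ‖z - z₀‖ < R := by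
  by_cases h0 : z₀.im = 0
  · obtain ⟨J, hJ, hxJ⟩ := exists_phi_eq x
    refine ⟨J, hJ, Or.inl h0, toC x, hxJ, ?_⟩
    have : phi I z₀ = phi J z₀ := by simp [phi, h0]
    rw [this, hxJ, phi_mem_shell hJ] at hx
    exact hx
  · have hR := hR.resolve_left h0
    -- Off the slice of the centre, `σ` is at least `|Im x| + |Im z₀| ≥ R`, so such points do not
    -- belong to the shell.
    have hs : SameSlice x (phi I z₀) := by
      by_contra hs
      have h2 := hx.2
      rw [sigma, if_neg hs, norm_imPart_phi hI] at h2
      refine absurd (hR.trans ?_) (not_le.2 h2)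
      refine Real.le_sqrt_of_sq_le ?_
      have h3 := norm_nonneg (imPart x)
      have h4 := abs_nonneg z₀.im
      nlinarith [sq_nonneg ‖rePart x - rePart (phi I z₀)‖]
    obtain ⟨K, hK, ⟨a, ha⟩, ⟨b, hb⟩⟩ := hs
    -- The centre is not real, so a slice containing it is spanned by `I` or `-I`.
    have hxI : ∃ z, x = phi I z := by
      rcases phi_eq_phi hI hK hb.symm with ⟨-, h | h⟩ | ⟨-, h⟩
      · exact absurd h h0
      · exact ⟨a, by rw [← ha, h]⟩
      · exact ⟨star a, by rw [← ha, h, ← phi_neg_star, neg_neg]⟩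
    obtain ⟨z, rfl⟩ := hxI
    exact ⟨I, hI, Or.inr rfl, z, rfl, (phi_mem_shell hI).1 hx⟩

theorem IsSingularPoint.eventually_mem_profile {U : Set A} {I : A} (hI : I ∈ imUnits A) {z₀ : ℂ}
    (h : IsSingularPoint U (phi I z₀)) : ∀ᶠ z in 𝓝[≠] z₀, phi I z ∈ U := by
  obtain ⟨R, hR, hs⟩ := h
  filter_upwards [self_mem_nhdsWithin, nhdsWithin_le_nhds (Metric.ball_mem_nhds z₀ hR)] with z h1 h2
  exact hs ((phi_mem_shell hI).2 ⟨h1, by rwa [← dist_eq_norm]⟩)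

/-- A radius at which a shell becomes contained in the slices through its centre. -/
theorem exists_small_radius (z₀ : ℂ) {R : ℝ} (hR : 0 < R) :
    ∃ r, 0 < r ∧ r ≤ R ∧ (z₀.im = 0 ∨ r ≤ |z₀.im|) := by
  by_cases h0 : z₀.im = 0
  · exact ⟨R, hR, le_rfl, Or.inl h0⟩
  · exact ⟨min R |z₀.im|, lt_min hR (abs_pos.2 h0), min_le_left _ _, Or.inr (min_le_right _ _)⟩

/-- For a centre off the real axis, `z̄₀` lies at distance `2|Im z₀| > r` from `z₀`; for a real
centre it is `z₀` itself. This keeps the binomial invertible in a small shell. -/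
theorem ne_star_of_norm_lt {z₀ z : ℂ} {r : ℝ} (hr : z₀.im = 0 ∨ r ≤ |z₀.im|) (hne : z ≠ z₀)
    (h : ‖z - z₀‖ < r) : z ≠ star z₀ := by
  rintro rfl
  rcases hr with h0 | h0
  · exact hne (Complex.ext (by simp) (by simp [h0]))
  · refine absurd (h0.trans ?_) (not_le.2 h)
    refine le_trans ?_ (Complex.abs_im_le_norm _)
    simp only [Complex.sub_im, Complex.star_def, Complex.conj_im]
    rw [show -z₀.im - z₀.im = -(2 * z₀.im) by ring, abs_neg, abs_mul, abs_two]
    linarith [abs_nonneg z₀.im]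

end Shell

/-! ### From poles and removable singularities to growth of the stem. -/

section PoleGrowth

/-- Submultiplicativity applied to `c` and to `c⁻¹` gives both inequalities; multiplicativity of the
norm on `A` is not among the assumed properties. -/
theorem norm_phi_mul {J : A} (hJ : J ∈ imUnits A) (c : ℂ) (a : A) :
    ‖phi J c * a‖ = ‖c‖ * ‖a‖ := by
  rcases eq_or_ne c 0 with rfl | hc
  · simp [phi]
  refine le_antisymm ((NonAssocNormedRing.norm_mul_le _ _).trans_eq (by rw [norm_phi hJ])) ?_
  have h : a = phi J c⁻¹ * (phi J c * a) := by
    rw [phi_mul_mul hJ, inv_mul_cancel₀ hc, phi_one, one_mul]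
  have h2 : ‖a‖ ≤ ‖c‖⁻¹ * ‖phi J c * a‖ := by
    nth_rw 1 [h]
    exact (NonAssocNormedRing.norm_mul_le _ _).trans_eq (by rw [norm_phi hJ, norm_inv])
  rwa [← div_eq_inv_mul, le_div_iff₀' (norm_pos_iff.2 hc)] at h2

/-- On the slice the expansion is an ordinary Laurent series. Boundedness of its terms at one radius
gives Cauchy-type bounds on the coefficients, and closer to the centre a geometric series starting
at index `-m` dominates. -/
theorem IsPole.growth {U : Set A} {f : A → A} {I : A} (hI : I ∈ imUnits A) {z₀ : ℂ}
    (h : IsPole U f (phi I z₀)) :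
    ∃ (m : ℕ) (C : ℝ), ∀ᶠ z in 𝓝[≠] z₀, ‖z - z₀‖ ^ m * ‖f (phi I z)‖ ≤ C := by
  obtain ⟨R, hR, hs, a, ha, m, hm⟩ := h
  obtain ⟨r, hr, hrR, hr'⟩ := exists_small_radius z₀ hR
  have hsum : ∀ z, z ≠ z₀ → ‖z - z₀‖ < r →
      HasSum (fun n : ℤ => phi I ((z - z₀) ^ n) * a n) (f (phi I z)) := by
    intro z h1 h2
    have h3 := ha z I hI ((phi_mem_shell hI).2 ⟨h1, h2.trans_le hrR⟩)
    refine h3.congr_fun fun n => ?_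
    exact ((inSlice_zpow_binomialStem hI h1 (ne_star_of_norm_lt hr' h1 h2) n).eval_mul_const
      hI _).symm
  have hρ : 0 < r / 2 := by positivity
  -- The terms of the convergent series at `z₀ + r/2` tend to zero, hence are bounded.
  obtain ⟨C, hC⟩ : ∃ C : ℝ, ∀ n : ℤ, (r / 2) ^ n * ‖a n‖ ≤ C := by
    have h1 := hsum (z₀ + (r / 2 : ℝ)) (by simpa using hr.ne')
      (by rw [add_sub_cancel_left, Complex.norm_real, Real.norm_of_nonneg hρ.le]; linarith)
    obtain ⟨C, hC⟩ := h1.summable.tendsto_cofinite_zero.norm.bddAbove_range_of_cofinite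
    refine ⟨C, fun n => ?_⟩
    have := hC (Set.mem_range_self n)
    rwa [norm_phi_mul hI, add_sub_cancel_left, norm_zpow, Complex.norm_real,
      Real.norm_of_nonneg hρ.le] at this
  have hC0 : 0 ≤ C := le_trans (by positivity) (hC 0)
  -- With `t = ‖z - z₀‖ / (r/2) ≤ 1/2` the geometric majorant is at most `2 C t⁻ᵐ`, and `‖z - z₀‖ᵐ =
  -- tᵐ (r/2)ᵐ`.
  refine ⟨m, 2 * C * (r / 2) ^ m, ?_⟩
  filter_upwards [self_mem_nhdsWithin,
    nhdsWithin_le_nhds (Metric.ball_mem_nhds z₀ (half_pos hρ))] with z h1 h2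
  rw [Metric.mem_ball, dist_eq_norm] at h2
  have hz0 : 0 < ‖z - z₀‖ := norm_pos_iff.2 (sub_ne_zero.2 h1)
  set t := ‖z - z₀‖ / (r / 2) with ht
  have ht0 : 0 < t := by positivity
  have ht1 : t ≤ 1 / 2 := by
    rw [ht, div_le_iff₀ hρ]; linarith
  have hinj : Function.Injective fun k : ℕ => (k : ℤ) - m := fun a b hab => by
    simpa using hab
  have hg : HasSum (fun n : ℤ => if n < -(m : ℤ) then 0 else C * t ^ n)
      (C * t ^ (-(m : ℤ)) * (1 - t)⁻¹) := by
    rw [← hinj.hasSum_iff]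
    · have := (hasSum_geometric_of_lt_one ht0.le (by linarith)).mul_left (C * t ^ (-(m : ℤ)))
      refine this.congr_fun fun k => ?_
      simp only [Function.comp]
      rw [if_neg (by omega), sub_eq_neg_add, zpow_add₀ ht0.ne', zpow_natCast]
      ring
    · intro n hn
      refine if_pos ?_
      by_contra hlt
      exact hn ⟨(n + m).toNat, by simp only; omega⟩
  have hle := (hsum z h1 (by linarith)).norm_le_of_bounded hg fun n => by
    split_ifs with hn
    · simp [hm n hn]
    · rw [norm_phi_mul hI, norm_zpow, ht, div_zpow, mul_div_assoc', mul_comm C, mul_div_assoc]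
      refine mul_le_mul_of_nonneg_left ?_ (by positivity)
      rw [le_div_iff₀ (by positivity), mul_comm]
      exact hC n
  have h5 : (1 - t)⁻¹ ≤ 2 := by
    rw [inv_le_comm₀ (by linarith) two_pos]; linarith
  have h6 : ‖z - z₀‖ = t * (r / 2) := by rw [ht]; field_simp
  calc ‖z - z₀‖ ^ m * ‖f (phi I z)‖ ≤ ‖z - z₀‖ ^ m * (C * t ^ (-(m : ℤ)) * 2) :=
        mul_le_mul_of_nonneg_left (hle.trans (mul_le_mul_of_nonneg_left h5 (by positivity)))
          (by positivity)
    _ = 2 * C * (r / 2) ^ m := by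
      rw [h6, mul_pow, zpow_neg, zpow_natCast]
      field_simp

theorem IsRemovable.growth {U : Set A} {f : A → A} {I : A} (hI : I ∈ imUnits A) {z₀ : ℂ}
    (h : IsRemovable U f (phi I z₀)) :
    ∃ (m : ℕ) (C : ℝ), ∀ᶠ z in 𝓝[≠] z₀, ‖z - z₀‖ ^ m * ‖f (phi I z)‖ ≤ C := by
  obtain ⟨hs, V, g, hUV, hyV, hg, hfg⟩ := h
  refine ⟨0, ‖g (phi I z₀)‖ + 1, ?_⟩
  filter_upwards [hs.eventually_mem_profile hI, nhdsWithin_le_nhds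
    ((hg.continuousAt_comp_phi hI hyV).norm.eventually_lt continuousAt_const
      (lt_add_one _))] with z h1 h2
  rw [pow_zero, one_mul, ← hfg h1]
  exact h2.le

theorem tendsto_star_nhdsNE (z₀ : ℂ) : Tendsto (star : ℂ → ℂ) (𝓝[≠] z₀) (𝓝[≠] (star z₀)) := by
  refine tendsto_nhdsWithin_iff.2 ⟨?_, ?_⟩
  · exact (continuous_star.tendsto z₀).mono_left nhdsWithin_le_nhds
  · filter_upwards [self_mem_nhdsWithin] with z hz h
    exact hz (star_injective h)

/-- The stem function of a slice regular function is meromorphic at poles and removable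
singularities. -/
theorem meromorphicStemAt_of_singular {U Ω : Set A} {F : ℂ → Complexification A} {f : A → A}
    (hU : IsCircular U) (ho : IsOpen U) (hΩ : IsCircular Ω)
    (hF : IsInducedBy U F f) (hol : IsHolomorphicStem (profile U) F)
    (hs : ∀ y ∈ Ω \ U, IsPole U f y ∨ IsRemovable U f y) {z₀ : ℂ} (hz₀ : z₀ ∈ profile Ω) :
    MeromorphicStemAt F z₀ := by
  by_cases hzU : z₀ ∈ profile U
  · exact HolomorphicStemAt.meromorphicStemAt
      (Filter.mem_of_superset ((isOpen_profile hU ho).mem_nhds hzU) hol)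
  obtain ⟨I, hI⟩ := IsHypercomplex.exists_imUnit (A := A)
  have hgrowth : ∀ z ∈ profile Ω, z ∉ profile U → (∀ᶠ w in 𝓝[≠] z, phi I w ∈ U) ∧
      ∃ (m : ℕ) (C : ℝ), ∀ᶠ w in 𝓝[≠] z, ‖w - z‖ ^ m * ‖f (phi I w)‖ ≤ C := by
    intro z h1 h2
    rcases hs (phi I z) ⟨(hΩ.phi_mem hI).2 h1, fun h => h2 ((hU.phi_mem hI).1 h)⟩ with h | h
    · exact ⟨IsSingularPoint.eventually_mem_profile hI ⟨_, h.choose_spec.1, h.choose_spec.2.1⟩,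
        h.growth hI⟩
    · exact ⟨h.1.eventually_mem_profile hI, h.growth hI⟩
  obtain ⟨hmem, m, C, h1⟩ := hgrowth z₀ hz₀ hzU
  -- Recovering `F` near `z₀` takes the values of `f` on both halves of the slice, so the growth at
  -- the conjugate point is needed too.
  obtain ⟨-, n, D, h2⟩ := hgrowth (star z₀) (profile_star hz₀)
    fun h => hzU (by simpa using profile_star h)
  have h2' := (tendsto_star_nhdsNE z₀).eventually h2
  have h2'' : ∀ᶠ w in 𝓝[≠] z₀, ‖w - z₀‖ ^ n * ‖f (phi I (star w))‖ ≤ D := by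
    filter_upwards [h2'] with w hw
    rwa [← star_sub, norm_star] at hw
  have h3 := growth_mono (Nat.le_add_right m n) h1
  have h4 := growth_mono (Nat.le_add_left n m) h2''
  have hbound : ∀ᶠ w in 𝓝[≠] z₀, ‖w - z₀‖ ^ (m + n) * (‖(F w).eval I‖ + ‖(F w).eval (-I)‖) ≤
      C + D := by
    filter_upwards [h3, h4, hmem] with w k1 k2 k3
    have k4 := (hU.phi_mem hI).1 k3
    rw [hF.2 w I hI k3] at k1
    rw [hF.eval_neg hI hU k4] at k2
    rw [mul_add]; exact add_le_add k1 k2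
  refine .of_eventually (m := m + n) (n := m + n) (C := C + D) (D := C + D) ?_ ?_ ?_
  · filter_upwards [hmem] with w hw
    exact hol w ((hU.phi_mem hI).1 hw)
  · filter_upwards [hbound] with w hw
    refine (mul_le_mul_of_nonneg_left ?_ (by positivity)).trans hw
    rw [re_eq_of_eval I, norm_smul]
    have := norm_add_le ((F w).eval I) ((F w).eval (-I))
    norm_num
    linarith [norm_nonneg ((F w).eval I), norm_nonneg ((F w).eval (-I))]
  · filter_upwards [hbound] with w hw
    refine (mul_le_mul_of_nonneg_left ?_ (by positivity)).trans hw
    rw [im_eq_of_eval hI, norm_neg]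
    refine (NonAssocNormedRing.norm_mul_le _ _).trans ?_
    rw [norm_imUnit hI, norm_smul]
    have := norm_sub_le ((F w).eval I) ((F w).eval (-I))
    norm_num
    linarith [norm_nonneg ((F w).eval I), norm_nonneg ((F w).eval (-I))]

end PoleGrowth

/-! ### From growth of the stem to a slice Laurent expansion. -/

section PoleOfMeromorphic

/-- The Laurent expansion of a meromorphic function, with real coefficients if the function is
compatible with complex conjugation. -/
theorem exists_laurent {g : ℂ → ℂ} {z₀ : ℂ} (hg : MeromorphicAt g z₀)
    (hreal : z₀.im = 0 → ∀ᶠ z in 𝓝[≠] z₀, g (star z) = star (g z)) :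
    ∃ (m : ℕ) (c : ℤ → ℂ), (∀ n < -(m : ℤ), c n = 0) ∧ (z₀.im = 0 → ∀ n, (c n).im = 0) ∧
      ∀ᶠ z in 𝓝[≠] z₀, HasSum (fun n : ℤ => (z - z₀) ^ n * c n) (g z) := by
  obtain ⟨m, c, hc, hsum⟩ : ∃ (m : ℕ) (c : ℤ → ℂ), (∀ n < -(m : ℤ), c n = 0) ∧
      ∀ᶠ z in 𝓝[≠] z₀, HasSum (fun n : ℤ => (z - z₀) ^ n * c n) (g z) := by
    obtain ⟨m, p, hp⟩ := hg
    rw [hasFPowerSeriesAt_iff'] at hp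
    -- The Taylor coefficients of `(z - z₀) ^ m • g z`, shifted down by `m`.
    refine ⟨m, fun n => if n < -(m : ℤ) then 0 else p.coeff (n + m).toNat,
      fun n hn => if_pos hn, ?_⟩
    filter_upwards [nhdsWithin_le_nhds hp, self_mem_nhdsWithin] with z hz hne
    have hne' : z - z₀ ≠ 0 := sub_ne_zero.2 hne
    have hinj : Function.Injective fun k : ℕ => (k : ℤ) - m := fun a b hab => by
      simpa using hab
    rw [← hinj.hasSum_iff]
    · have h := hz.mul_left ((z - z₀) ^ (-(m : ℤ)))
      rw [smul_eq_mul, ← mul_assoc, zpow_neg, zpow_natCast, inv_mul_cancel₀ (pow_ne_zero _ hne'),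
        one_mul] at h
      refine h.congr_fun fun k => ?_
      simp only [Function.comp]
      rw [if_neg (by omega), sub_add_cancel, Int.toNat_natCast, sub_eq_neg_add (k : ℤ), zpow_add₀ hne',
        zpow_neg, zpow_natCast, zpow_natCast, smul_eq_mul, mul_assoc]
    · intro n hn
      rw [if_pos, mul_zero]
      by_contra hlt
      exact hn ⟨(n + m).toNat, by simp only; omega⟩
  by_cases h0 : z₀.im = 0
  · have hz₀ : star z₀ = z₀ := Complex.ext (by simp) (by simp [h0])
    -- At a real centre, averaging the expansion at `z` with the conjugate of the one at `z̄`
    -- replaces each coefficient by its real part without changing the sum.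
    refine ⟨m, fun n => ((c n).re : ℂ), fun n hn => by simp [hc n hn], fun _ n => by simp, ?_⟩
    have hsum' := tendsto_star_nhdsNE z₀
    rw [hz₀] at hsum'
    filter_upwards [hsum, hsum'.eventually hsum, hreal h0] with z h1 h2 h3
    rw [h3] at h2
    have h4 := (h1.add (Complex.hasSum_conj'.2 h2)).mul_left (2⁻¹ : ℂ)
    have h5 : (2⁻¹ : ℂ) * (g z + starRingEnd ℂ (star (g z))) = g z := by
      rw [Complex.star_def, Complex.conj_conj]; ring
    rw [h5] at h4
    refine h4.congr_fun fun n => ?_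
    rw [Complex.re_eq_add_conj, map_mul, map_zpow₀, map_sub]
    simp only [← Complex.star_def]
    rw [star_star, hz₀]
    ring
  · exact ⟨m, c, hc, fun h => absurd h h0, hsum⟩

/-- Splits `A ⊗ ℂ` along a real basis of `A`, so that an `A`-valued expansion becomes finitely many
scalar ones. -/
theorem eval_eq_sum {ι : Type*} [Fintype ι] (b : Module.Basis ι ℝ A) (J : A)
    (w : Complexification A) : w.eval J = ∑ i, phi J (coordC (b.coord i) w) * b i := by
  simp only [phi, coordC, add_mul, smul_mul_assoc, one_mul, Finset.sum_add_distrib, eval,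
    Module.Basis.coord_apply]
  congr 1
  · exact (b.sum_repr _).symm
  · nth_rw 1 [← b.sum_repr w.im]
    rw [Finset.mul_sum]
    simp only [mul_smul_comm]

theorem hasSum_phi_mul (J : A) {g : ℤ → ℂ} {s : ℂ} (h : HasSum g s) (a : A) :
    HasSum (fun n => phi J (g n) * a) (phi J s * a) :=
  (((mulL A).flip a).comp (phiL J)).hasSum h

/-- Each basis coordinate of `F` has a scalar Laurent series with coefficients `c_{i,n}`, and on the
slice through the centre these add up to the slice series with `a_n = ∑ φ_I(c_{i,n}) b_i`. If the
centre is not real, a small shell lies in one slice. If it is real, the shell meets all slices, but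
then the `c_{i,n}` are real and `φ_I(c_{i,n})` is the same for every `I`. -/
theorem isPole_of_meromorphicStemAt {U : Set A} {F : ℂ → Complexification A} {f : A → A}
    (hU : IsCircular U) (hF : IsInducedBy U F f) {I : A} (hI : I ∈ imUnits A) {z₀ : ℂ}
    (hmem : ∀ᶠ z in 𝓝[≠] z₀, z ∈ profile U) (hmer : MeromorphicStemAt F z₀) :
    IsPole U f (phi I z₀) := by
  have := IsHypercomplex.finiteDimensional (A := A)
  let b := Module.finBasis ℝ A
  have hL := fun i => exists_laurent (hmer.meromorphicAt_coordC (b.coord i)) fun _ => by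
    filter_upwards [hmem] with z hz
    rw [hF.1 z hz, coordC_conj]
  choose m c hc hreal hsum using hL
  have hall := (eventually_all.2 hsum).and hmem
  obtain ⟨R, hR, hball⟩ := Metric.mem_nhdsWithin_iff.1 hall
  obtain ⟨r, hr, hrR, hr'⟩ := exists_small_radius z₀ hR
  have hin : ∀ z, z ≠ z₀ → ‖z - z₀‖ < r →
      (∀ i, HasSum (fun n : ℤ => (z - z₀) ^ n * c i n) (coordC (b.coord i) (F z))) ∧
        z ∈ profile U := fun z h1 h2 =>
    hball ⟨by rw [Metric.mem_ball, dist_eq_norm]; exact h2.trans_le hrR, h1⟩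
  -- The sum of the `m i` serves only as a common bound for the pole orders of the coordinates.
  refine ⟨r, hr, ?_, fun n => ∑ i, phi I (c i n) * b i, ?_, ∑ i, m i, ?_⟩
  · intro x hx
    obtain ⟨J, hJ, -, z, rfl, h1, h2⟩ := exists_slice_of_mem_shell hI hr' hx
    exact (hU.phi_mem hJ).2 (hin z h1 h2).2
  · intro w K hK hx
    obtain ⟨J, hJ, hJI, z, hz, h1, h2⟩ := exists_slice_of_mem_shell hI hr' hx
    obtain ⟨h3, h4⟩ := hin z h1 h2
    have hy : phi I z₀ = phi J z₀ := by
      rcases hJI with h | h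
      · simp [phi, h]
      · rw [h]
    have hcJ : ∀ i n, phi I (c i n) = phi J (c i n) := by
      intro i n
      rcases hJI with h | h
      · simp [phi, hreal i h n]
      · rw [h]
    rw [hz, hF.2 z J hJ ((hU.phi_mem hJ).2 h4), eval_eq_sum b]
    have h5 : HasSum (fun n : ℤ => ∑ i, phi J ((z - z₀) ^ n * c i n) * b i)
        (∑ i, phi J (coordC (b.coord i) (F z)) * b i) :=
      hasSum_sum fun i _ => hasSum_phi_mul J (h3 i) (b i)
    refine h5.congr_fun fun n => ?_
    -- The given coordinates `(w, K)` of the point are traded for coordinates `(z, J)` in a slice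
    -- containing the centre.
    have h6 := eval_eq_of_phi_eq hK hJ (F := fun z => (binomialStem (phi I z₀) z).zpow n *
      const (∑ i, phi I (c i n) * b i)) (by
        rw [Complexification.conj_mul, conj_zpow, binomialStem_star]
        congr 1
        ext1 <;> simp) hz
    rw [h6]
    rw [hy, (inSlice_zpow_binomialStem hJ h1 (ne_star_of_norm_lt hr' h1 h2) n).eval_mul_const hJ,
      Finset.mul_sum]
    refine Finset.sum_congr rfl fun i _ => ?_
    rw [hcJ, phi_mul_mul hJ]
  · intro n hn
    refine Finset.sum_eq_zero fun i _ => ?_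
    have hle : m i ≤ ∑ i, m i := Finset.single_le_sum (fun _ _ => Nat.zero_le _) (Finset.mem_univ i)
    rw [hc i n (by omega)]
    simp [phi]

end PoleOfMeromorphic

end SliceRegular

/-! ### The algebra of semiregular functions -/

namespace Filter.Germ

variable {α R : Type*} {l : Filter α} [NonAssocRing R] [StarRing R]

instance : StarRing (Germ l R) where
  star := map star
  star_involutive x := inductionOn x fun f => congrArg ofFun (funext fun z => star_star (f z))
  star_mul x y := inductionOn₂ x y fun f g =>
    congrArg ofFun (funext fun z => star_mul (f z) (g z))
  star_add x y := inductionOn₂ x y fun f g =>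
    congrArg ofFun (funext fun z => star_add (f z) (g z))

theorem coe_star (f : α → R) : star (f : Germ l R) = ((fun z => star (f z) : α → R) : Germ l R) :=
  rfl

end Filter.Germ

namespace SliceRegular

set_option linter.unusedSectionVars false

variable {A : Type*} [NonAssocNormedRing A] [StarRing A] [NormedSpace ℝ A] [IsHypercomplex A]

open Complexification Filter

/-- Circular open sets. -/
class IsCircularOpen (Ω : Set A) : Prop where
  isOpen : IsOpen Ω
  isCircular : IsCircular Ω

/-- `F` is a holomorphic stem function on the profile of `U ⊆ Ω` which is meromorphic on the profile
of `Ω`. -/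
structure IsSemiregularStem (Ω U : Set A) (F : ℂ → Complexification A) : Prop where
  isOpen : IsOpen U
  isCircular : IsCircular U
  subset : U ⊆ Ω
  stem : IsStem (profile U) F
  hol : IsHolomorphicStem (profile U) F
  punctured : ∀ z ∈ profile Ω, ∀ᶠ w in 𝓝[≠] z, w ∈ profile U
  mer : ∀ z ∈ profile Ω, MeromorphicStemAt F z

namespace IsSemiregularStem

variable {Ω U V : Set A} {F G : ℂ → Complexification A}

theorem add (hF : IsSemiregularStem Ω U F) (hG : IsSemiregularStem Ω V G) :
    IsSemiregularStem Ω (U ∩ V) (fun z => F z + G z) where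
  isOpen := hF.isOpen.inter hG.isOpen
  isCircular := hF.isCircular.inter hG.isCircular
  subset := Set.inter_subset_left.trans hF.subset
  stem z hz := by
    beta_reduce
    rw [hF.stem z (profile_mono Set.inter_subset_left hz),
      hG.stem z (profile_mono Set.inter_subset_right hz), conj_add]
  hol z hz := HolomorphicStemAt.add (hF.hol z (profile_mono Set.inter_subset_left hz))
    (hG.hol z (profile_mono Set.inter_subset_right hz))
  punctured z hz := by
    rw [hG.isCircular.profile_inter]
    exact (hF.punctured z hz).and (hG.punctured z hz)
  mer z hz := (hF.mer z hz).add (hG.mer z hz)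

theorem mul (hF : IsSemiregularStem Ω U F) (hG : IsSemiregularStem Ω V G) :
    IsSemiregularStem Ω (U ∩ V) (fun z => F z * G z) where
  isOpen := hF.isOpen.inter hG.isOpen
  isCircular := hF.isCircular.inter hG.isCircular
  subset := Set.inter_subset_left.trans hF.subset
  stem z hz := by
    beta_reduce
    rw [hF.stem z (profile_mono Set.inter_subset_left hz),
      hG.stem z (profile_mono Set.inter_subset_right hz), Complexification.conj_mul]
  hol z hz := HolomorphicStemAt.mul (hF.hol z (profile_mono Set.inter_subset_left hz))
    (hG.hol z (profile_mono Set.inter_subset_right hz))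
  punctured z hz := by
    rw [hG.isCircular.profile_inter]
    exact (hF.punctured z hz).and (hG.punctured z hz)
  mer z hz := (hF.mer z hz).mul (hG.mer z hz)

theorem star (hF : IsSemiregularStem Ω U F) : IsSemiregularStem Ω U (fun z => star (F z)) where
  isOpen := hF.isOpen
  isCircular := hF.isCircular
  subset := hF.subset
  stem z hz := by
    beta_reduce
    rw [hF.stem z hz, conj_star]
  hol z hz := HolomorphicStemAt.star (hF.hol z hz)
  punctured := hF.punctured
  mer z hz := (hF.mer z hz).star

theorem rsmul (r : ℝ) (hF : IsSemiregularStem Ω U F) :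
    IsSemiregularStem Ω U (fun z => r • F z) where
  isOpen := hF.isOpen
  isCircular := hF.isCircular
  subset := hF.subset
  stem z hz := by
    beta_reduce
    rw [hF.stem z hz]
    ext1 <;> simp
  hol z hz := HolomorphicStemAt.csmul (g := fun _ => (r : ℂ)) (differentiableAt_const _)
    (hF.hol z hz)
  punctured := hF.punctured
  mer z hz := (hF.mer z hz).csmul (g := fun _ => (r : ℂ)) (MeromorphicAt.const _ _)

theorem const [h : IsCircularOpen Ω] (a : A) :
    IsSemiregularStem Ω Ω (fun _ => Complexification.const a) where
  isOpen := h.isOpen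
  isCircular := h.isCircular
  subset := subset_rfl
  stem z hz := by ext1 <;> simp
  hol z hz := holomorphicStemAt_const _
  punctured z hz := nhdsWithin_le_nhds ((isOpen_profile h.isCircular h.isOpen).mem_nhds hz)
  mer z hz := meromorphicStemAt_const _

/-- The reciprocal of a semiregular stem function whose norm does not vanish identically near any
point. -/
theorem inv (hF : IsSemiregularStem Ω U F)
    (hne : ∀ z ∈ profile Ω, ∀ᶠ w in 𝓝[≠] z, normC (F w) ≠ 0) :
    IsSemiregularStem Ω (circularization A {z | z ∈ profile U ∧ normC (F z) ≠ 0})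
      (fun z => (normC (F z))⁻¹ • Star.star (F z)) := by
  have hs : ∀ z ∈ {z | z ∈ profile U ∧ normC (F z) ≠ 0},
      Star.star z ∈ {z | z ∈ profile U ∧ normC (F z) ≠ 0} := fun z hz =>
    ⟨profile_star hz.1, by rw [hF.stem z hz.1, normC_conj]; exact star_ne_zero.2 hz.2⟩
  have hp := profile_circularization (A := A) hs
  refine ⟨isOpen_circularization hs ?_, isCircular_circularization _, ?_, ?_, ?_, ?_, ?_⟩
  · rw [isOpen_iff_mem_nhds]
    intro z hz
    filter_upwards [(isOpen_profile hF.isCircular hF.isOpen).mem_nhds hz.1,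
      (HolomorphicStemAt.differentiableAt_normC (hF.hol z hz.1)).continuousAt.eventually_ne hz.2]
      with w h1 h2 using ⟨h1, h2⟩
  · rintro x ⟨z, hz, J, hJ, rfl⟩
    exact hF.subset ((hF.isCircular.phi_mem hJ).2 hz.1)
  · rw [hp]
    intro z hz
    beta_reduce
    rw [hF.stem z hz.1, normC_conj, Complex.star_def, ← map_inv₀, ← conj_star]
    ext1
    · simp only [conj_re, csmul_re, Complex.conj_re, Complex.conj_im, conj_im, neg_smul, smul_neg,
        neg_neg]
    · simp only [conj_re, conj_im, csmul_im, Complex.conj_re, Complex.conj_im, neg_smul, smul_neg,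
        neg_add]
  · rw [hp]
    intro z hz
    have h1 : HolomorphicStemAt F z := hF.hol z hz.1
    exact HolomorphicStemAt.csmul (h1.differentiableAt_normC.inv hz.2) h1.star
  · intro z hz
    rw [hp]
    exact (hF.punctured z hz).and (hne z hz)
  · intro z hz
    exact (hF.mer z hz).star.csmul (hF.mer z hz).meromorphicAt_normC.inv

/-- The semiregular function induced by a semiregular stem function. -/
noncomputable def toFun (hF : IsSemiregularStem Ω U F) : SemiregularFun Ω where
  dom := U
  toFun := induced F
  dom_subset := hF.subset
  regular := ⟨hF.isOpen, hF.isCircular, F, isInducedBy_induced hF.stem, hF.hol⟩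
  singular y hy := by
    -- Every missing point counts as a pole, since a pole may have `m = 0`; removable singularities
    -- need no separate treatment.
    left
    obtain ⟨I, hI, h⟩ := exists_phi_eq y
    rw [h] at hy ⊢
    have hz : toC y ∈ profile Ω := ⟨I, hI, hy.1⟩
    exact isPole_of_meromorphicStemAt hF.isCircular (isInducedBy_induced hF.stem) hI
      (hF.punctured _ hz) (hF.mer _ hz)

theorem isInducedBy (hF : IsSemiregularStem Ω U F) : IsInducedBy U F hF.toFun.toFun :=
  isInducedBy_induced hF.stem

end IsSemiregularStem

variable {Ω : Set A}

/-- The filter ignores points outside the profile; as the profile is open, this exemption disappears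
near each of its points. -/
theorem eventually_codiscreteWithin_profile [h : IsCircularOpen Ω] {p : ℂ → Prop} :
    (∀ᶠ w in codiscreteWithin (profile Ω), p w) ↔ ∀ z ∈ profile Ω, ∀ᶠ w in 𝓝[≠] z, p w := by
  rw [Filter.Eventually, mem_codiscreteWithin_iff_forall_mem_nhdsNE]
  refine forall₂_congr fun z hz => ⟨fun h1 => ?_, fun h1 => mem_of_superset h1 fun w hw => Or.inl hw⟩
  filter_upwards [h1, nhdsWithin_le_nhds
    ((isOpen_profile h.isCircular h.isOpen).mem_nhds hz)] with w h2 h3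
  exact h2.resolve_right fun h4 => h4 h3

namespace SemiregularFun

/-- The stem function of a semiregular function. -/
noncomputable def stem (f : SemiregularFun Ω) : ℂ → Complexification A :=
  f.regular.2.2.choose

theorem isInducedBy_stem (f : SemiregularFun Ω) : IsInducedBy f.dom f.stem f.toFun :=
  f.regular.2.2.choose_spec.1

theorem isCircular_dom (f : SemiregularFun Ω) : IsCircular f.dom := f.regular.2.1

theorem isSemiregularStem [h : IsCircularOpen Ω] (f : SemiregularFun Ω) :
    IsSemiregularStem Ω f.dom f.stem where
  isOpen := f.regular.1
  isCircular := f.regular.2.1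
  subset := f.dom_subset
  stem := f.isInducedBy_stem.1
  hol := f.regular.2.2.choose_spec.2
  punctured z hz := by
    obtain ⟨I, hI⟩ := IsHypercomplex.exists_imUnit (A := A)
    by_cases hzU : z ∈ profile f.dom
    · exact nhdsWithin_le_nhds ((isOpen_profile f.regular.2.1 f.regular.1).mem_nhds hzU)
    · have := f.isSingularPoint (y := phi I z) ⟨(h.isCircular.phi_mem hI).2 hz,
        fun h => hzU ((f.regular.2.1.phi_mem hI).1 h)⟩
      filter_upwards [this.eventually_mem_profile hI] with w hw
      exact ⟨I, hI, hw⟩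
  mer z hz := meromorphicStemAt_of_singular f.regular.2.1 f.regular.1 h.isCircular
    f.isInducedBy_stem f.regular.2.2.choose_spec.2 f.singular hz

/-- The germ of the stem function along the filter of complements of discrete sets. -/
noncomputable def germ (f : SemiregularFun Ω) :
    Germ (codiscreteWithin (profile Ω)) (Complexification A) := (f.stem : _)

/-- Equal functions have equal stems on the common profile, whose complement in the profile of `Ω`
is discrete. Conversely, stems that agree on punctured neighbourhoods agree at the centre by
continuity. -/
theorem equiv_iff_germ_eq [IsCircularOpen Ω] (f g : SemiregularFun Ω) :
    f ≈ g ↔ f.germ = g.germ := by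
  rw [germ, germ, Germ.coe_eq, EventuallyEq, eventually_codiscreteWithin_profile]
  constructor
  · intro h z hz
    have := f.isInducedBy_stem.eqOn g.isInducedBy_stem f.isCircular_dom g.isCircular_dom h
    filter_upwards [f.isSemiregularStem.punctured z hz, g.isSemiregularStem.punctured z hz]
      with w h1 h2 using this ⟨h1, h2⟩
  · rintro h x ⟨hxf, hxg⟩
    obtain ⟨J, hJ, hx⟩ := exists_phi_eq x
    rw [hx] at hxf hxg ⊢
    rw [f.isInducedBy_stem.2 _ J hJ hxf, g.isInducedBy_stem.2 _ J hJ hxg]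
    have hf := f.isSemiregularStem.hol _ ⟨J, hJ, hxf⟩
    have hg := g.isSemiregularStem.hol _ ⟨J, hJ, hxg⟩
    have he := h (toC x) ⟨J, hJ, f.dom_subset hxf⟩
    have key : ∀ u v : ℂ → A, ContinuousAt u (toC x) → ContinuousAt v (toC x) →
        (∀ᶠ w in 𝓝[≠] (toC x), u w = v w) → u (toC x) = v (toC x) := fun u v hu hv huv =>
      tendsto_nhds_unique ((hu.tendsto.mono_left nhdsWithin_le_nhds).congr' huv)
        (hv.tendsto.mono_left nhdsWithin_le_nhds)
    congr 1
    ext1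
    · exact key _ _ (HolomorphicStemAt.continuousAt_re hf) (HolomorphicStemAt.continuousAt_re hg)
        (he.mono fun w hw => by rw [hw])
    · exact key _ _ (HolomorphicStemAt.continuousAt_im hf) (HolomorphicStemAt.continuousAt_im hg)
        (he.mono fun w hw => by rw [hw])

theorem germ_toFun [IsCircularOpen Ω] {U : Set A} {F : ℂ → Complexification A}
    (hF : IsSemiregularStem Ω U F) : hF.toFun.germ = (F : Germ _ _) := by
  rw [germ, Germ.coe_eq, EventuallyEq, eventually_codiscreteWithin_profile]
  intro z hz
  have := hF.toFun.isInducedBy_stem.eqOn hF.isInducedBy hF.toFun.isCircular_dom hF.isCircular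
    fun _ _ => rfl
  filter_upwards [hF.punctured z hz] with w h1
  exact this ⟨h1, h1⟩

end SemiregularFun

/-! ### The algebra structure on `SEM Ω`, transported from germs of stems. -/

namespace SEM

variable [IsCircularOpen Ω]

/-- The germ of the stem function of an element of `SEM(Ω)`. -/
noncomputable def germ (a : SEM Ω) : Germ (codiscreteWithin (profile Ω)) (Complexification A) :=
  Quotient.lift SemiregularFun.germ (fun f g h => (f.equiv_iff_germ_eq g).1 h) a

@[simp] theorem germ_mk (f : SemiregularFun Ω) : (mk f).germ = f.germ := rfl

theorem germ_injective : Function.Injective (germ : SEM Ω → _) := by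
  intro a b
  induction a using Quotient.inductionOn
  induction b using Quotient.inductionOn
  exact fun h => Quotient.sound ((SemiregularFun.equiv_iff_germ_eq _ _).2 h)

theorem exists_mk (a : SEM Ω) : ∃ f, mk f = a := Quotient.exists_rep a

noncomputable instance : Zero (SEM Ω) := ⟨mk (IsSemiregularStem.const 0).toFun⟩
noncomputable instance : One (SEM Ω) := ⟨mk (IsSemiregularStem.const 1).toFun⟩
-- The operations use chosen representatives. Laws are checked on germs, and `mk_add_mk` and its
-- analogues show afterwards that any representatives give the same result.
noncomputable instance : Add (SEM Ω) := ⟨fun a b =>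
  mk (a.out.isSemiregularStem.add b.out.isSemiregularStem).toFun⟩
noncomputable instance : Mul (SEM Ω) := ⟨fun a b =>
  mk (a.out.isSemiregularStem.mul b.out.isSemiregularStem).toFun⟩
noncomputable instance : SMul ℝ (SEM Ω) := ⟨fun r a => mk (a.out.isSemiregularStem.rsmul r).toFun⟩
noncomputable instance : Neg (SEM Ω) := ⟨fun a => (-1 : ℝ) • a⟩
noncomputable instance : Star (SEM Ω) := ⟨fun a => mk a.out.isSemiregularStem.star.toFun⟩

theorem germ_out (a : SEM Ω) : (Quotient.out a).germ = a.germ :=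
  congrArg germ (Quotient.out_eq a)

@[simp] theorem germ_zero : (0 : SEM Ω).germ = 0 := SemiregularFun.germ_toFun _
@[simp] theorem germ_one : (1 : SEM Ω).germ = 1 := SemiregularFun.germ_toFun _
@[simp] theorem germ_add (a b : SEM Ω) : (a + b).germ = a.germ + b.germ := by
  rw [← germ_out a, ← germ_out b]; exact SemiregularFun.germ_toFun _
@[simp] theorem germ_mul (a b : SEM Ω) : (a * b).germ = a.germ * b.germ := by
  rw [← germ_out a, ← germ_out b]; exact SemiregularFun.germ_toFun _
@[simp] theorem germ_smul (r : ℝ) (a : SEM Ω) : (r • a).germ = r • a.germ := by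
  rw [← germ_out a]; exact SemiregularFun.germ_toFun _
@[simp] theorem germ_neg (a : SEM Ω) : (-a).germ = -a.germ := by
  rw [← neg_one_smul ℝ a.germ]; exact germ_smul _ _
@[simp] theorem germ_star (a : SEM Ω) : (star a).germ = star a.germ := by
  rw [← germ_out a]; exact SemiregularFun.germ_toFun _

noncomputable instance : AddCommGroup (SEM Ω) where
  add_assoc a b c := germ_injective (by simp [add_assoc])
  zero_add a := germ_injective (by simp)
  add_zero a := germ_injective (by simp)
  nsmul := nsmulRec
  zsmul := zsmulRec
  neg_add_cancel a := germ_injective (by simp)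
  add_comm a b := germ_injective (by simp [add_comm])

noncomputable instance : NonAssocRing (SEM Ω) where
  __ := (inferInstance : AddCommGroup (SEM Ω))
  left_distrib a b c := germ_injective (by simp [mul_add])
  right_distrib a b c := germ_injective (by simp [add_mul])
  zero_mul a := germ_injective (by simp)
  mul_zero a := germ_injective (by simp)
  one_mul a := germ_injective (by simp)
  mul_one a := germ_injective (by simp)

noncomputable instance : StarRing (SEM Ω) where
  star_involutive a := germ_injective (by simp)
  star_mul a b := germ_injective (by simp)
  star_add a b := germ_injective (by simp)

noncomputable instance : Module ℝ (SEM Ω) where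
  one_smul a := germ_injective (by simp)
  mul_smul r s a := germ_injective (by simp [mul_smul])
  smul_zero r := germ_injective (by simp)
  smul_add r a b := germ_injective (by simp)
  add_smul r s a := germ_injective (by simp [add_smul])
  zero_smul a := germ_injective (by simp)

theorem mk_add_mk (f g : SemiregularFun Ω) :
    mk f + mk g = mk (f.isSemiregularStem.add g.isSemiregularStem).toFun :=
  germ_injective (by rw [germ_add]; exact (SemiregularFun.germ_toFun _).symm)

theorem mk_mul_mk (f g : SemiregularFun Ω) :
    mk f * mk g = mk (f.isSemiregularStem.mul g.isSemiregularStem).toFun :=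
  germ_injective (by rw [germ_mul]; exact (SemiregularFun.germ_toFun _).symm)

theorem smul_mk (r : ℝ) (f : SemiregularFun Ω) :
    r • mk f = mk (f.isSemiregularStem.rsmul r).toFun :=
  germ_injective (by rw [germ_smul]; exact (SemiregularFun.germ_toFun _).symm)

theorem star_mk (f : SemiregularFun Ω) : star (mk f) = mk f.isSemiregularStem.star.toFun :=
  germ_injective (by rw [germ_star]; exact (SemiregularFun.germ_toFun _).symm)

theorem smul_mul (r : ℝ) (a b : SEM Ω) : (r • a) * b = r • (a * b) := by
  refine germ_injective ?_
  rw [germ_mul, germ_smul, germ_smul, germ_mul]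
  exact Germ.inductionOn₂ a.germ b.germ fun F G =>
    congrArg Germ.ofFun (funext fun z => rsmul_mul r (F z) (G z))

theorem mul_smul' (r : ℝ) (a b : SEM Ω) : a * (r • b) = r • (a * b) := by
  refine germ_injective ?_
  rw [germ_mul, germ_smul, germ_smul, germ_mul]
  exact Germ.inductionOn₂ a.germ b.germ fun F G =>
    congrArg Germ.ofFun (funext fun z => mul_rsmul r (F z) (G z))

theorem star_smul' (r : ℝ) (a : SEM Ω) : star (r • a) = r • star a := by
  refine germ_injective ?_
  rw [germ_star, germ_smul, germ_smul, germ_star]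
  exact Germ.inductionOn a.germ fun F =>
    congrArg Germ.ofFun (funext fun z => star_rsmul r (F z))

theorem left_alt (a b : SEM Ω) : (a * a) * b = a * (a * b) := by
  refine germ_injective ?_
  simp only [germ_mul]
  exact Germ.inductionOn₂ a.germ b.germ fun F G =>
    congrArg Germ.ofFun (funext fun z => Complexification.left_alt (F z) (G z))

theorem right_alt (a b : SEM Ω) : (a * b) * b = a * (b * b) := by
  refine germ_injective ?_
  simp only [germ_mul]
  exact Germ.inductionOn₂ a.germ b.germ fun F G =>
    congrArg Germ.ofFun (funext fun z => Complexification.right_alt (F z) (G z))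

/-- The function `N(f)⁻¹ fᶜ` is an inverse of `f` in the strong sense that multiplications by the two
functions are inverse to each other. -/
theorem exists_inverse (f : SemiregularFun Ω)
    (h : ∀ z ∈ profile Ω, ∀ᶠ w in 𝓝[≠] z, normC (f.stem w) ≠ 0) :
    ∃ b : SEM Ω, ∀ x : SEM Ω, mk f * (b * x) = x ∧ b * (mk f * x) = x ∧ (x * b) * mk f = x ∧
      (x * mk f) * b = x := by
  have hev := eventually_codiscreteWithin_profile.2 h
  have hf : f.germ = (f.stem : Germ _ _) := rfl
  refine ⟨mk (f.isSemiregularStem.inv h).toFun, fun x => ⟨?_, ?_, ?_, ?_⟩⟩ <;>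
  · refine germ_injective ?_
    simp only [germ_mul, germ_mk, SemiregularFun.germ_toFun, hf]
    refine Germ.inductionOn x.germ fun F => Germ.coe_eq.2 ?_
    filter_upwards [hev] with z hz
    first
    | exact Complexification.mul_inv_cancel_left hz _
    | exact Complexification.inv_mul_cancel_left hz _
    | exact Complexification.inv_mul_cancel_right hz _
    | exact Complexification.mul_inv_cancel_right hz _

theorem mk_eq_zero_iff (f : SemiregularFun Ω) :
    mk f = 0 ↔ ∀ z ∈ profile Ω, ∀ᶠ w in 𝓝[≠] z, f.stem w = 0 := by
  rw [← germ_injective.eq_iff, germ_zero, germ_mk, SemiregularFun.germ, ← Germ.coe_zero,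
    Germ.coe_eq, EventuallyEq, eventually_codiscreteWithin_profile]
  rfl

theorem mk_mul_star_eq_zero_iff (f : SemiregularFun Ω) :
    mk f * star (mk f) = 0 ↔ ∀ z ∈ profile Ω, ∀ᶠ w in 𝓝[≠] z, normC (f.stem w) = 0 := by
  rw [← germ_injective.eq_iff, germ_zero, germ_mul, germ_star, germ_mk, SemiregularFun.germ,
    Germ.coe_star, ← Germ.coe_mul, ← Germ.coe_zero, Germ.coe_eq, EventuallyEq,
    eventually_codiscreteWithin_profile]
  have hn : ∀ w, (f.stem * fun z => star (f.stem z)) w = 0 ↔ normC (f.stem w) = 0 := by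
    intro w
    rw [Pi.mul_apply, mul_star_self]
    refine ⟨fun h => ?_, fun h => by rw [h, zero_smul]⟩
    have h1 := congrArg Complexification.re h
    have h2 := congrArg Complexification.im h
    have h0 := IsHypercomplex.one_ne_zero' A
    apply Complex.ext
    · simpa [h0] using h1
    · simpa [h0] using h2
  exact forall₂_congr fun z _ => eventually_congr (.of_forall hn)

end SEM

end SliceRegular

/-! ### Slice domains and product domains -/

namespace SliceRegular

set_option linter.unusedSectionVars false

variable {A : Type*} [NonAssocNormedRing A] [StarRing A] [NormedSpace ℝ A] [IsHypercomplex A]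

open Complexification Filter

section Identity

variable {g : ℂ → ℂ} {C : Set ℂ} {x y : ℂ}

/-- The identity theorem for meromorphic functions. -/
theorem eventually_eq_zero_of_isPreconnected (hg : MeromorphicOn g C) (hC : IsPreconnected C)
    (hx : x ∈ C) (hy : y ∈ C) (h : ∀ᶠ w in 𝓝[≠] x, g w = 0) : ∀ᶠ w in 𝓝[≠] y, g w = 0 := by
  rw [← meromorphicOrderAt_eq_top_iff] at h ⊢
  by_contra hne
  exact hg.meromorphicOrderAt_ne_top_of_isPreconnected hC hy hx hne h

/-- Real points accumulate at `r`, which is what the identity theorem requires of the zeros found on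
the real axis. -/
theorem frequently_real (r : ℝ) : ∃ᶠ w in 𝓝[≠] (r : ℂ), w.im = 0 := by
  have h : Tendsto (fun t : ℝ => (t : ℂ)) (𝓝[≠] r) (𝓝[≠] (r : ℂ)) := by
    refine tendsto_nhdsWithin_iff.2 ⟨?_, ?_⟩
    · exact (Complex.continuous_ofReal.tendsto r).mono_left nhdsWithin_le_nhds
    · filter_upwards [self_mem_nhdsWithin] with t ht h
      exact ht (Complex.ofReal_injective h)
  exact h.frequently (Eventually.of_forall fun t => Complex.ofReal_im t).frequently

end Identity

theorem eq_zero_of_coordC {ι : Type*} (b : Module.Basis ι ℝ A) {w : Complexification A}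
    (h : ∀ i, coordC (b.coord i) w = 0) : w = 0 := by
  ext1
  · refine b.ext_elem fun i => ?_
    simpa [coordC] using congrArg Complex.re (h i)
  · refine b.ext_elem fun i => ?_
    simpa [coordC] using congrArg Complex.im (h i)

variable {Ω : Set A} [IsCircularOpen Ω]

/-- On a slice domain the norm of a nonzero semiregular function does not vanish identically near
any point. -/
theorem eventually_normC_ne_zero_of_isSliceDomain (h : IsSliceDomain Ω) {f : SemiregularFun Ω}
    (hf : SEM.mk f ≠ 0) : ∀ z ∈ profile Ω, ∀ᶠ w in 𝓝[≠] z, normC (f.stem w) ≠ 0 := by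
  obtain ⟨D, -, hconn, hstar, ⟨r, hr⟩, hΩ⟩ := h
  have hD : profile Ω = D := by rw [hΩ, profile_circularization hstar]
  have hF := f.isSemiregularStem
  rw [hD]
  intro z hz
  have hn : MeromorphicOn (fun w => normC (f.stem w)) D := fun w hw =>
    (hF.mer w (hD ▸ hw)).meromorphicAt_normC
  -- A meromorphic scalar vanishes identically or nowhere on a small punctured disc; the first case
  -- is to be excluded.
  refine (hn z hz).eventually_eq_zero_or_eventually_ne_zero.resolve_left fun h0 => hf ?_
  have hr0 := eventually_eq_zero_of_isPreconnected hn hconn.isPreconnected hz hr h0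
  -- At real points `F₂ = 0`, so `n(F) = |F₁|²` and its vanishing forces `F = 0`.
  have hfreq : ∃ᶠ w in 𝓝[≠] (r : ℂ), f.stem w = 0 := by
    refine ((frequently_real r).and_eventually (hr0.and (hF.punctured r (hD ▸ hr)))).mono ?_
    rintro w ⟨hw, hw0, hwU⟩
    have hw' : star w = w := Complex.ext (by simp) (by simp [hw])
    have h1 := hF.stem w hwU
    rw [hw'] at h1
    have h2 := eq_zero_of_conj_eq h1.symm
    have h3 : ‖(f.stem w).re‖ ^ 2 = 0 := by
      simpa [normC, h2] using congrArg Complex.re hw0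
    have h4 : (f.stem w).re = 0 := by simpa using h3
    exact Complexification.ext h4 h2
  have := IsHypercomplex.finiteDimensional (A := A)
  let b := Module.finBasis ℝ A
  rw [SEM.mk_eq_zero_iff, hD]
  intro y hy
  have hcoord : ∀ i, ∀ᶠ w in 𝓝[≠] y, coordC (b.coord i) (f.stem w) = 0 := by
    intro i
    have hm : MeromorphicOn (fun w => coordC (b.coord i) (f.stem w)) D := fun w hw =>
      (hF.mer w (hD ▸ hw)).meromorphicAt_coordC _
    refine eventually_eq_zero_of_isPreconnected hm hconn.isPreconnected hr hy ?_
    -- Zeros of the coordinate accumulate at `r`, which rules out the nonvanishing alternative.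
    refine (hm r hr).eventually_eq_zero_or_eventually_ne_zero.resolve_right fun hne => ?_
    refine hfreq (hne.mono fun w hw hw0 => hw ?_)
    rw [hw0]
    apply Complex.ext <;> simp [coordC]
  filter_upwards [eventually_all.2 hcoord] with w hw using eq_zero_of_coordC b hw

theorem isDivisionAlgebra_of_isSliceDomain (h : IsSliceDomain Ω) (hne : Ω.Nonempty) :
    IsDivisionAlgebra (SEM Ω) := by
  refine ⟨⟨1, 0, fun h10 => ?_⟩, fun a ha => ?_⟩
  · obtain ⟨J, hJ, hx⟩ := exists_phi_eq hne.some
    have hz : toC hne.some ∈ profile Ω := ⟨J, hJ, hx ▸ hne.some_mem⟩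
    have h1 := congrArg SEM.germ h10
    rw [SEM.germ_one, SEM.germ_zero, ← Germ.coe_one, ← Germ.coe_zero, Germ.coe_eq, EventuallyEq,
      eventually_codiscreteWithin_profile] at h1
    obtain ⟨w, hw⟩ := (h1 _ hz).exists
    exact IsHypercomplex.one_ne_zero' A (congrArg Complexification.re hw)
  · obtain ⟨f, rfl⟩ := SEM.exists_mk a
    obtain ⟨b, hb⟩ := SEM.exists_inverse f (eventually_normC_ne_zero_of_isSliceDomain h ha)
    refine ⟨⟨b, ?_, ?_⟩, ⟨fun x y hxy => ?_, fun y => ⟨b * y, (hb y).1⟩⟩,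
      ⟨fun x y hxy => ?_, fun y => ⟨y * b, (hb y).2.2.1⟩⟩⟩
    · simpa using (hb 1).1
    · simpa using (hb 1).2.1
    · rw [← (hb x).2.1, ← (hb y).2.1]
      exact congrArg (b * ·) hxy
    · rw [← (hb x).2.2.2, ← (hb y).2.2.2]
      exact congrArg (· * b) hxy

/-- On a product domain the norm of a semiregular function vanishes identically, or it does not
vanish identically near any point. -/
theorem eventually_normC_ne_zero_of_isProductDomain (h : IsProductDomain Ω) {f : SemiregularFun Ω}
    (hf : SEM.mk f * star (SEM.mk f) ≠ 0) :
    ∀ z ∈ profile Ω, ∀ᶠ w in 𝓝[≠] z, normC (f.stem w) ≠ 0 := by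
  obtain ⟨D, -, -, ⟨z₁, hz₁, -, hunion, -, himage⟩, hΩ⟩ := h
  set C := connectedComponentIn D z₁ with hC
  have hCD : C ⊆ D := connectedComponentIn_subset D z₁
  rw [← himage] at hunion
  have hstar : ∀ z ∈ D, star z ∈ D := by
    intro z hz
    rw [hunion] at hz ⊢
    rcases hz with hz | ⟨w, hw, rfl⟩
    · exact Or.inr ⟨z, hz, rfl⟩
    · rw [star_star]; exact Or.inl hw
  have hD : profile Ω = D := by rw [hΩ, profile_circularization hstar]
  have hF := f.isSemiregularStem
  rw [hD]
  intro z hz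
  have hn : MeromorphicOn (fun w => normC (f.stem w)) D := fun w hw =>
    (hF.mer w (hD ▸ hw)).meromorphicAt_normC
  refine (hn z hz).eventually_eq_zero_or_eventually_ne_zero.resolve_left fun h0 => hf ?_
  -- `n(F(z̄))` is the conjugate of `n(F(z))`, so vanishing passes between the two components.
  have hsymm : ∀ y ∈ D, (∀ᶠ w in 𝓝[≠] y, normC (f.stem w) = 0) →
      ∀ᶠ w in 𝓝[≠] (star y), normC (f.stem w) = 0 := by
    intro y hy h1
    have h2 := tendsto_star_nhdsNE (star y)
    rw [star_star] at h2
    filter_upwards [h2.eventually h1, hF.punctured (star y) (hD ▸ hstar y hy)] with w h3 h4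
    rwa [hF.stem w h4, normC_conj, star_eq_zero] at h3
  have hCzero : ∀ y ∈ C, ∀ᶠ w in 𝓝[≠] y, normC (f.stem w) = 0 := by
    intro y hy
    have key : ∀ x ∈ C, (∀ᶠ w in 𝓝[≠] x, normC (f.stem w) = 0) →
        ∀ᶠ w in 𝓝[≠] y, normC (f.stem w) = 0 := fun x hx =>
      eventually_eq_zero_of_isPreconnected (hn.mono_set hCD) isPreconnected_connectedComponentIn
        hx hy
    rcases hunion ▸ hz with hz' | ⟨u, hu, rfl⟩
    · exact key z hz' h0
    · exact key u hu (by simpa using hsymm _ hz h0)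
  rw [SEM.mk_mul_star_eq_zero_iff, hD]
  intro y hy
  rcases hunion ▸ hy with hy' | ⟨u, hu, rfl⟩
  · exact hCzero y hy'
  · exact hsymm u (hCD hu) (hCzero u hu)

theorem exists_inverse_of_isProductDomain (h : IsProductDomain Ω) {a : SEM Ω}
    (ha : a * star a ≠ 0) : ∃ b : SEM Ω, a * b = 1 ∧ b * a = 1 := by
  obtain ⟨f, rfl⟩ := SEM.exists_mk a
  obtain ⟨b, hb⟩ := SEM.exists_inverse f (eventually_normC_ne_zero_of_isProductDomain h ha)
  exact ⟨b, by simpa using (hb 1).1, by simpa using (hb 1).2.1⟩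

-- The witness comes from the zero divisor `1 + ιJ`, for which `n = |1|² - |J|² + 2i Re(Jᶜ) = 0`.
-- The stem condition forces the value `1 - ιJ` on the conjugate component, and since the components
-- are open and disjoint the stem is locally constant, hence holomorphic.
open Classical in
theorem exists_ne_zero_mul_star_eq_zero (h : IsProductDomain Ω) :
    ∃ a : SEM Ω, a ≠ 0 ∧ a * star a = 0 := by
  obtain ⟨D, hDo, -, ⟨z₁, hz₁, -, hunion, hdisj, himage⟩, hΩ⟩ := h
  have hCo : IsOpen (connectedComponentIn D z₁) := hDo.connectedComponentIn
  have hCo' : IsOpen (connectedComponentIn D (star z₁)) := hDo.connectedComponentIn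
  set C := connectedComponentIn D z₁ with hC
  set C' := connectedComponentIn D (star z₁) with hC'
  have hCC' : ∀ z ∈ C, star z ∈ C' := fun z hz => himage ▸ ⟨z, hz, rfl⟩
  have hC'C : ∀ z ∈ C', star z ∈ C := by
    intro z hz
    rw [← himage] at hz
    obtain ⟨w, hw, rfl⟩ := hz
    rwa [star_star]
  have hstar : ∀ z ∈ D, star z ∈ D := by
    intro z hz
    rw [hunion] at hz ⊢
    exact hz.elim (fun h => Or.inr (hCC' z h)) fun h => Or.inl (hC'C z h)
  have hD : profile Ω = D := by rw [hΩ, profile_circularization hstar]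
  obtain ⟨J, hJ⟩ := IsHypercomplex.exists_imUnit (A := A)
  let p : Complexification A := ⟨1, J⟩
  let P : ℂ → Complexification A := fun z => if z ∈ C then p else p.conj
  have hPC : ∀ z ∈ C, P z = p := fun z hz => if_pos hz
  have hPC' : ∀ z ∈ C', P z = p.conj := fun z hz => if_neg (hdisj.notMem_of_mem_right hz)
  have hPhol : ∀ z ∈ D, HolomorphicStemAt P z := by
    intro z hz
    rw [hunion] at hz
    rcases hz with hz | hz
    · exact (holomorphicStemAt_const p).congr
        (mem_of_superset (hCo.mem_nhds hz) fun w hw => (hPC w hw).symm)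
    · exact (holomorphicStemAt_const p.conj).congr
        (mem_of_superset (hCo'.mem_nhds hz) fun w hw => (hPC' w hw).symm)
  have hpre : ∀ w, (P w).re = 1 := fun w => by
    by_cases hw : w ∈ C <;> simp [P, hw, p]
  have hp0 : normC p = 0 := by
    apply Complex.ext
    · simp [normC, p, norm_imUnit hJ, IsHypercomplex.norm_one]
    · simp [normC, p, star_imUnit hJ, re_imUnit hJ]
  have hP0 : ∀ w, normC (P w) = 0 := fun w => by
    by_cases hw : w ∈ C
    · simp [P, hw, hp0]
    · simp [P, hw, normC_conj, hp0]
  have hP : IsSemiregularStem Ω Ω P := by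
    refine ⟨IsCircularOpen.isOpen, IsCircularOpen.isCircular, subset_rfl, ?_, ?_, ?_, ?_⟩
    · rw [hD]
      intro z hz
      rw [hunion] at hz
      rcases hz with hz | hz
      · rw [hPC z hz, hPC' _ (hCC' z hz)]
      · rw [hPC' z hz, hPC _ (hC'C z hz), conj_conj]
    · rw [hD]; exact hPhol
    · rw [hD]
      exact fun z hz => nhdsWithin_le_nhds (hDo.mem_nhds hz)
    · rw [hD]
      exact fun z hz => HolomorphicStemAt.meromorphicStemAt
        (mem_of_superset (hDo.mem_nhds hz) hPhol)
  have hgerm : (SEM.mk hP.toFun).germ = (P : Germ _ _) := SemiregularFun.germ_toFun hP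
  refine ⟨SEM.mk hP.toFun, fun h0 => ?_, ?_⟩
  · have h1 := congrArg SEM.germ h0
    rw [hgerm, SEM.germ_zero, ← Germ.coe_zero, Germ.coe_eq, EventuallyEq,
      eventually_codiscreteWithin_profile] at h1
    obtain ⟨w, hw⟩ := (h1 z₁ (hD ▸ hz₁)).exists
    refine IsHypercomplex.one_ne_zero' A ?_
    rw [← hpre w, hw]
    rfl
  · refine SEM.germ_injective ?_
    rw [SEM.germ_mul, SEM.germ_star, hgerm, SEM.germ_zero, Germ.coe_star, ← Germ.coe_mul,
      ← Germ.coe_zero, Germ.coe_eq]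
    refine Eventually.of_forall fun w => ?_
    rw [Pi.mul_apply, mul_star_self, hP0, zero_smul]
    rfl

end SliceRegular

/-! ### Assembly of the theorem. -/

theorem mainTheorem8 (k : HypercomplexType) (Ω : Set k.Carrier)
    (hopen : IsOpen Ω) (hcirc : IsCircular Ω) (hne : Ω.Nonempty) :
    ∃ (_ : NonAssocRing (SEM Ω)) (_ : StarRing (SEM Ω)) (_ : Module ℝ (SEM Ω)),
      -- the operations are `+`, scalar multiplication, the slice product, slice conjugation,
      -- and the unit is the constant function `1`
      (∀ f g : SemiregularFun Ω, ∃ h : SemiregularFun Ω, h.dom = f.dom ∩ g.dom ∧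
        (∀ x ∈ h.dom, h.toFun x = f.toFun x + g.toFun x) ∧
        SEM.mk f + SEM.mk g = SEM.mk h) ∧
      (∀ (r : ℝ) (f : SemiregularFun Ω), ∃ h : SemiregularFun Ω, h.dom = f.dom ∧
        (∀ x ∈ h.dom, h.toFun x = r • f.toFun x) ∧
        r • SEM.mk f = SEM.mk h) ∧
      (∀ f g : SemiregularFun Ω, ∃ h : SemiregularFun Ω, h.dom = f.dom ∩ g.dom ∧
        IsSliceProduct h.dom f.toFun g.toFun h.toFun ∧
        SEM.mk f * SEM.mk g = SEM.mk h) ∧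
      (∀ f : SemiregularFun Ω, ∃ h : SemiregularFun Ω, h.dom = f.dom ∧
        IsSliceConj h.dom f.toFun h.toFun ∧
        star (SEM.mk f) = SEM.mk h) ∧
      (∃ h : SemiregularFun Ω, h.dom = Ω ∧ (∀ x ∈ Ω, h.toFun x = 1) ∧ 1 = SEM.mk h) ∧
      -- `SEM Ω` is a real algebra with a linear involution, and it is alternative
      (∀ (r : ℝ) (a b : SEM Ω), (r • a) * b = r • (a * b) ∧ a * (r • b) = r • (a * b)) ∧
      (∀ (r : ℝ) (a : SEM Ω), star (r • a) = r • star a) ∧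
      (∀ a b : SEM Ω, (a * a) * b = a * (a * b) ∧ (a * b) * b = a * (b * b) ∧
        (a * b) * a = a * (b * a)) ∧
      -- slice domains
      (IsSliceDomain Ω → IsDivisionAlgebra (SEM Ω)) ∧
      -- product domains
      (IsProductDomain Ω →
        (∃ a : SEM Ω, a ≠ 0 ∧ a * star a = 0) ∧
        ∀ a : SEM Ω, a * star a ≠ 0 → ∃ b : SEM Ω, a * b = 1 ∧ b * a = 1) := by
  have : IsCircularOpen Ω := ⟨hopen, hcirc⟩
  refine ⟨inferInstance, inferInstance, inferInstance, fun f g => ?_, fun r f => ?_, fun f g => ?_,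
    fun f => ?_, ?_, fun r a b => ⟨SEM.smul_mul r a b, SEM.mul_smul' r a b⟩, SEM.star_smul',
    fun a b => ⟨SEM.left_alt a b, SEM.right_alt a b, flexible_of_alt SEM.left_alt SEM.right_alt a b⟩,
    fun h => isDivisionAlgebra_of_isSliceDomain h hne,
    fun h => ⟨exists_ne_zero_mul_star_eq_zero h, fun a => exists_inverse_of_isProductDomain h⟩⟩
  · have hs := f.isSemiregularStem.add g.isSemiregularStem
    refine ⟨hs.toFun, rfl, fun x hx => ?_, SEM.mk_add_mk f g⟩
    obtain ⟨J, hJ, h⟩ := exists_phi_eq x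
    rw [h] at hx ⊢
    rw [hs.isInducedBy.2 _ J hJ hx, f.isInducedBy_stem.2 _ J hJ hx.1,
      g.isInducedBy_stem.2 _ J hJ hx.2, Complexification.eval_add]
  · have hs := f.isSemiregularStem.rsmul r
    refine ⟨hs.toFun, rfl, fun x hx => ?_, SEM.smul_mk r f⟩
    obtain ⟨J, hJ, h⟩ := exists_phi_eq x
    rw [h] at hx ⊢
    rw [hs.isInducedBy.2 _ J hJ hx, f.isInducedBy_stem.2 _ J hJ hx]
    simp [Complexification.eval, mul_smul_comm]
  · have hs := f.isSemiregularStem.mul g.isSemiregularStem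
    exact ⟨hs.toFun, rfl, ⟨f.stem, g.stem, f.isInducedBy_stem.mono Set.inter_subset_left,
      g.isInducedBy_stem.mono Set.inter_subset_right, hs.isInducedBy⟩, SEM.mk_mul_mk f g⟩
  · have hs := f.isSemiregularStem.star
    exact ⟨hs.toFun, rfl, ⟨f.stem, f.isInducedBy_stem, hs.isInducedBy⟩, SEM.star_mk f⟩
  · have hs := IsSemiregularStem.const (Ω := Ω) 1
    refine ⟨hs.toFun, rfl, fun x hx => ?_, rfl⟩
    obtain ⟨J, hJ, h⟩ := exists_phi_eq x
    rw [h] at hx ⊢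
    rw [hs.isInducedBy.2 _ J hJ hx, Complexification.eval_const]
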